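/- **Setting.** Let $\Phi^t:\Omega\to\Omega$, $t\in\mathbb R$, be a continuous flow on a metric space $\Omega$ with an invariant, ergodic Borel probability measure $\mu$ whose support $X$ is compact (and carries $\mu$). Let $M\subseteq\Omega$ be a forward-invariant compact $C^1$ manifold (possibly with boundary) with $X\subseteq M$, such that each $\Phi^t|_M$, $t\ge 0$, is $C^1$ and the semiflow $\Phi^t|_M$, $t\ge0$, is generated by a continuous vector field $\vec V$ on $M$; put $\mathcal V f=\vec V\cdot\nabla f$ for $f\in C^1(M)$. Let $F:\Omega\to Y$ be a continuous map into a Banach space with $F|_M$ of class $C^1$, let $d(x,x')=\|F(x)-F(x')\|_Y$, and assume that $d^2$ is $C^1$ on $M\times M$. Let $h:[0,\infty)\to(0,\infty)$ be $C^1$ and bounded with bounded derivative. For $T>0$ put $$d_T^2(x,x')=\frac1T\int_0^T d^2(\Phi^t(x),\Phi^t(x'))\,dt,\qquad k_T=h\circ d_T^2,\qquad K_Tf=\int_\Omega k_T(\cdot,x)f(x)\,d\mu(x),\quad f\in L^2(\mu),$$ with $L^2(\mu)$ complex and $\langle f,g\rangle=\int f^*g\,d\mu$. Let $U^tf=f\circ\Phi^t$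 be the Koopman operators on $L^2(\mu)$ and $V$ the generator of the group $(U^t)_{t\in\mathbb R}$, with domain $D(V)$. Fix a continuous Riemannian metric on $M$ and the product metric on $M\times M$; the $C^1$ norms are $\|f\|_{C^1}=\max\{\sup|f|,\sup\|df\|\}$, and $\|\mathcal V\|$ is the norm of $\mathcal V:C^1(M)\to C(M)$. For $\epsilon\ge0$, $z\neq 0$ is an $\epsilon$-approximate eigenfunction of $U^t$ for $c\in\mathbb C$, and $c$ lies in the $\epsilon$-approximate point spectrum of $U^t$, if $\|U^tz-cz\|\le\epsilon\|z\|$. **Theorem.** Let $\phi,\psi$ be mutually orthogonal, unit-norm, real eigenfunctions of $K_T$ with eigenvalues $0<\lambda_T\le\nu_T$, respectively, which are simple if distinct and twofold-degenerate if equal. Set $$z=\tfrac1{\sqrt2}(\phi+i\psi),\quad \alpha_t=\langle z,U^tz\rangle,\quad \delta_T=\tfrac1{\sqrt2}(\nu_T-\lambda_T),\quad \tilde\delta_T=\delta_T/\nu_T,$$ $$\gamma_T=\inf_{u\in\sigma_p(K_T)\setminus\{\lambda_T,\nu_T\}}\min\{|\lambda_T-u|,|\nu_T-u|\},$$ $$s_t=\frac1{\gamma_T}\Big(\frac{C_1t}{T}+3\delta_T\Big),\qquad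 S_t=\frac{C_2\|\mathcal V\|(1+\tilde\delta_T)}{\lambda_T}\int_0^ts_u\,du,$$ $$C_1=2\|h\|_{C^1([0,\infty))}\|d^2\|_{C(X\times X)},\qquad C_2=2\|h\|_{C^1([0,\infty))}\|d^2\|_{C^1(M\times M)}.$$ Then $\gamma_T>0$, $\phi,\psi,z\in D(V)$, and $$\omega:=\langle\phi,V\psi\rangle=-\langle\psi,V\phi\rangle=\frac1i\langle z,Vz\rangle=\frac1i\dot\alpha_t\big|_{t=0}$$ is real. Moreover: (i) For every $t\ge0$, $\alpha_t$ lies in the $\tilde\epsilon_t$-approximate point spectrum of $U^t$, with $z$ a corresponding $\tilde\epsilon_t$-approximate eigenfunction, for $\tilde\epsilon_t=s_t+\sqrt{S_t}$. (ii) $|\omega|$ does not depend on the choice of the real orthonormal basis $\{\phi,\psi\}$: for all real orthonormal $\phi',\psi'$ in the sum of the eigenspaces of $\lambda_T$ and $\nu_T$, $\phi'\in D(V)$ and $|\langle\psi',V\phi'\rangle|=|\omega|$. Moreover, for every $t\ge0$, $|\alpha_t-e^{i\omega t}|\le2\sqrt{S_t}$. -/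

import Mathlib

open Set MeasureTheory
open scoped Manifold ENNReal

noncomputable section

namespace DelayCoherence

/-! ### Ergodic flows and Koopman operators -/

section Flow

variable {Ω : Type*} [MetricSpace Ω] [MeasurableSpace Ω]

/-- `μ` is invariant and ergodic under the flow `Φ`: every Borel set that is invariant under all
the maps `Φ t` is null or conull. -/
structure IsErgodicFlow (Φ : Flow ℝ Ω) (μ : Measure Ω) : Prop where
  measurePreserving : ∀ t : ℝ, MeasurePreserving (Φ t) μ μ
  ergodic : ∀ s : Set Ω, MeasurableSet s → (∀ t : ℝ, Φ t ⁻¹' s = s) → μ s = 0 ∨ μ sᶜ = 0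

/-- The Koopman operator `U^t f = f ∘ Φ^t` on `L²(μ)`. -/
def koopman (Φ : Flow ℝ Ω) (μ : Measure Ω) (hμ : IsErgodicFlow Φ μ) (t : ℝ) :
    Lp ℂ 2 μ →ₗᵢ[ℂ] Lp ℂ 2 μ :=
  Lp.compMeasurePreservingₗᵢ ℂ (Φ t) (hμ.measurePreserving t)

/-- The generator `V` of the Koopman group: `V f` is the derivative of `t ↦ U^t f` at `t = 0`
(in the norm of `L²(μ)`), the domain being the set of all `f` for which it exists. -/
def generator (Φ : Flow ℝ Ω) (μ : Measure Ω) (hμ : IsErgodicFlow Φ μ) :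
    Lp ℂ 2 μ →ₗ.[ℂ] Lp ℂ 2 μ where
  domain :=
    { carrier := {f | DifferentiableAt ℝ (fun t : ℝ => koopman Φ μ hμ t f) 0}
      add_mem' := by
        intro f g hf hg
        simp only [mem_ofPred_eq, map_add] at *
        exact hf.fun_add hg
      zero_mem' := by
        simp only [mem_ofPred_eq, map_zero]
        exact differentiableAt_const _
      smul_mem' := by
        intro c f hf
        simp only [mem_ofPred_eq, map_smul] at *
        exact hf.fun_const_smul c }
  toFun :=
    { toFun := fun f => deriv (fun t : ℝ => koopman Φ μ hμ t f) 0
      map_add' := by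
        intro f g
        simp only [Submodule.coe_add, map_add]
        exact deriv_fun_add f.2 g.2
      map_smul' := by
        intro c f
        simp only [Submodule.coe_smul, map_smul, RingHom.id_apply]
        exact deriv_fun_const_smul c f.2 }

end Flow

/-! ### Approximate point spectrum -/

section Approx

variable {𝓗 : Type*} [NormedAddCommGroup 𝓗] [NormedSpace ℂ 𝓗]

/-- `z` is an `ε`-approximate eigenfunction of `A` for the `ε`-approximate eigenvalue `c`. -/
def IsApproxEigenfunction (A : 𝓗 → 𝓗) (ε : ℝ) (c : ℂ) (z : 𝓗) : Prop :=
  z ≠ 0 ∧ ‖A z - c • z‖ ≤ ε * ‖z‖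

/-- The `ε`-approximate point spectrum of `A`. -/
def approxPointSpectrum (A : 𝓗 → 𝓗) (ε : ℝ) : Set ℂ :=
  {c | ∃ z, IsApproxEigenfunction A ε c z}

/-- The set of the real eigenvalues of `A` (for a self-adjoint `A`, its point spectrum). -/
def realPointSpectrum (A : 𝓗 →L[ℂ] 𝓗) : Set ℝ :=
  {u | Module.End.HasEigenvalue (A : 𝓗 →ₗ[ℂ] 𝓗) (u : ℂ)}

/-- The eigenspace of `A` for the real number `u`. -/
def eigenspace (A : 𝓗 →L[ℂ] 𝓗) (u : ℝ) : Submodule ℂ 𝓗 :=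
  Module.End.eigenspace (A : 𝓗 →ₗ[ℂ] 𝓗) (u : ℂ)

/-- The gap between `{a, b}` and the rest of the point spectrum. -/
def spectralGap (A : 𝓗 →L[ℂ] 𝓗) (a b : ℝ) : ℝ :=
  sInf ((fun u : ℝ => min |a - u| |b - u|) '' (realPointSpectrum A \ {a, b}))

end Approx

/-! ### Integral operators with bounded continuous kernels -/

section Kernel

variable {Ω : Type*} [MetricSpace Ω] [MeasurableSpace Ω] [BorelSpace Ω]

/-- A jointly continuous, bounded real kernel. -/
structure IsBoundedKernel (k : Ω → Ω → ℝ) : Prop where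
  continuous : Continuous (fun p : Ω × Ω => k p.1 p.2)
  bounded : ∃ C : ℝ, ∀ x y, |k x y| ≤ C

/-- The everywhere defined function `x ↦ ∫ k(x, y) f(y) dμ(y)`. -/
def kernelIntegral (μ : Measure Ω) (k : Ω → Ω → ℝ) (f : Ω → ℂ) (x : Ω) : ℂ :=
  ∫ y, (k x y : ℂ) * f y ∂μ

set_option linter.unusedSectionVars false

variable {μ : Measure Ω} [IsProbabilityMeasure μ] {k : Ω → Ω → ℝ}

theorem aestronglyMeasurable_kernel_mul (hk : IsBoundedKernel k) {f : Ω → ℂ}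
    (hf : AEStronglyMeasurable f μ) (x : Ω) :
    AEStronglyMeasurable (fun y => (k x y : ℂ) * f y) μ := by
  have h1 : Continuous (fun y => (k x y : ℂ)) :=
    Complex.continuous_ofReal.comp (hk.continuous.comp (Continuous.prodMk_right x))
  exact h1.aestronglyMeasurable.mul hf

theorem norm_kernel_mul_le {C : ℝ} (hC : ∀ x y, |k x y| ≤ C) (f : Ω → ℂ) (x y : Ω) :
    ‖(k x y : ℂ) * f y‖ ≤ C * ‖f y‖ := by
  rw [norm_mul, Complex.norm_real, Real.norm_eq_abs]
  exact mul_le_mul_of_nonneg_right (hC x y) (norm_nonneg _)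

theorem integrable_kernel_mul (hk : IsBoundedKernel k) {f : Ω → ℂ} (hf : Integrable f μ) (x : Ω) :
    Integrable (fun y => (k x y : ℂ) * f y) μ := by
  obtain ⟨C, hC⟩ := hk.bounded
  exact (hf.norm.const_mul C).mono' (aestronglyMeasurable_kernel_mul hk hf.1 x)
    (Filter.Eventually.of_forall fun y => norm_kernel_mul_le hC f x y)

theorem continuous_kernelIntegral (hk : IsBoundedKernel k) {f : Ω → ℂ} (hf : Integrable f μ) :
    Continuous (kernelIntegral μ k f) := by
  obtain ⟨C, hC⟩ := hk.bounded
  refine continuous_of_dominated (bound := fun y => C * ‖f y‖)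
    (fun x => aestronglyMeasurable_kernel_mul hk hf.1 x)
    (fun x => Filter.Eventually.of_forall fun y => norm_kernel_mul_le hC f x y)
    (hf.norm.const_mul C) (Filter.Eventually.of_forall fun y => ?_)
  exact (Complex.continuous_ofReal.comp
    (hk.continuous.comp (Continuous.prodMk_left y))).mul continuous_const

theorem norm_kernelIntegral_le {C : ℝ} (hC : ∀ x y, |k x y| ≤ C) {f : Ω → ℂ}
    (hf : Integrable f μ) (x : Ω) : ‖kernelIntegral μ k f x‖ ≤ C * ∫ y, ‖f y‖ ∂μ := by
  rw [← integral_const_mul]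
  exact norm_integral_le_of_norm_le (hf.norm.const_mul C)
    (Filter.Eventually.of_forall fun y => norm_kernel_mul_le hC f x y)

theorem integrable_of_Lp_two (f : Lp ℂ 2 μ) : Integrable f μ :=
  (Lp.memLp f).integrable (by norm_num)

theorem integral_norm_le_norm_Lp_two (f : Lp ℂ 2 μ) : ∫ y, ‖f y‖ ∂μ ≤ ‖f‖ := by
  have h1 : eLpNorm f 1 μ ≤ eLpNorm f 2 μ :=
    eLpNorm_le_eLpNorm_of_exponent_le (by norm_num) (Lp.aestronglyMeasurable f)
  rw [integral_norm_eq_lintegral_enorm (Lp.aestronglyMeasurable f), Lp.norm_def,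
    ← eLpNorm_one_eq_lintegral_enorm]
  exact ENNReal.toReal_mono (Lp.eLpNorm_ne_top f) h1

theorem memLp_kernelIntegral (hk : IsBoundedKernel k) (f : Lp ℂ 2 μ) :
    MemLp (kernelIntegral μ k f) 2 μ := by
  obtain ⟨C, hC⟩ := hk.bounded
  exact MemLp.of_bound (continuous_kernelIntegral hk (integrable_of_Lp_two f)).aestronglyMeasurable
    (C * ∫ y, ‖f y‖ ∂μ)
    (Filter.Eventually.of_forall fun x => norm_kernelIntegral_le hC (integrable_of_Lp_two f) x)

/-- The integral operator `(K f)(x) = ∫ k(x, y) f(y) dμ(y)`, as a linear map on `L²(μ)`. -/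
def kernelLinearMap (μ : Measure Ω) [IsProbabilityMeasure μ] (k : Ω → Ω → ℝ)
    (hk : IsBoundedKernel k) : Lp ℂ 2 μ →ₗ[ℂ] Lp ℂ 2 μ where
  toFun f := (memLp_kernelIntegral hk f).toLp (kernelIntegral μ k f)
  map_add' f g := by
    rw [← MemLp.toLp_add]
    congr 1
    funext x
    simp only [kernelIntegral, Pi.add_apply]
    rw [← integral_add (integrable_kernel_mul hk (integrable_of_Lp_two f) x)
      (integrable_kernel_mul hk (integrable_of_Lp_two g) x)]
    refine integral_congr_ae ?_
    filter_upwards [Lp.coeFn_add f g] with y hy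
    rw [hy, Pi.add_apply, mul_add]
  map_smul' c f := by
    rw [RingHom.id_apply, ← MemLp.toLp_const_smul]
    congr 1
    funext x
    simp only [kernelIntegral, Pi.smul_apply, smul_eq_mul]
    rw [← integral_const_mul]
    refine integral_congr_ae ?_
    filter_upwards [Lp.coeFn_smul c f] with y hy
    rw [hy, Pi.smul_apply, smul_eq_mul]
    ring

theorem exists_bound_kernelLinearMap (hk : IsBoundedKernel k) :
    ∃ C : ℝ, ∀ f : Lp ℂ 2 μ, ‖kernelLinearMap μ k hk f‖ ≤ C * ‖f‖ := by
  obtain ⟨C, hC⟩ := hk.bounded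
  have hC' : ∀ x y, |k x y| ≤ |C| := fun x y => (hC x y).trans (le_abs_self C)
  refine ⟨|C|, fun f => ?_⟩
  have hb : ∀ᵐ x ∂μ, ‖(kernelLinearMap μ k hk f) x‖ ≤ |C| * ‖f‖ := by
    filter_upwards [(memLp_kernelIntegral hk f).coeFn_toLp] with x hx
    refine (congrArg norm hx).le.trans
      ((norm_kernelIntegral_le hC' (integrable_of_Lp_two f) x).trans ?_)
    exact mul_le_mul_of_nonneg_left (integral_norm_le_norm_Lp_two f) (abs_nonneg C)
  simpa [measureUnivNNReal] using Lp.norm_le_of_ae_bound (by positivity) hb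

/-- The integral operator `(K f)(x) = ∫ k(x, y) f(y) dμ(y)`, as a bounded operator on `L²(μ)`. -/
def kernelOp (μ : Measure Ω) [IsProbabilityMeasure μ] (k : Ω → Ω → ℝ) (hk : IsBoundedKernel k) :
    Lp ℂ 2 μ →L[ℂ] Lp ℂ 2 μ :=
  (kernelLinearMap μ k hk).mkContinuousOfExistsBound (exists_bound_kernelLinearMap hk)

end Kernel

/-! ### Kernels built from delay-coordinate maps -/

section Delay

variable {Ω : Type*} [MetricSpace Ω] {Y : Type*} [NormedAddCommGroup Y]

/-- A shape function on `[0, ∞)`: positive, `C¹`, bounded, with bounded derivative. -/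
structure IsShapeFunction (h : ℝ → ℝ) : Prop where
  pos : ∀ u, 0 ≤ u → 0 < h u
  contDiffOn : ContDiffOn ℝ 1 h (Ici 0)
  bounded : ∃ C : ℝ, ∀ u, 0 ≤ u → h u ≤ C
  bounded_deriv : ∃ C : ℝ, ∀ u, 0 ≤ u → |derivWithin h (Ici 0) u| ≤ C

/-- The `C¹` norm on `[0, ∞)`. -/
def halfLineC1Norm (h : ℝ → ℝ) : ℝ :=
  max (⨆ u : Ici (0 : ℝ), |h u|) (⨆ u : Ici (0 : ℝ), |derivWithin h (Ici 0) u|)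

/-- `d²(x, y) = ‖F x - F y‖²`. -/
def sqDist (F : Ω → Y) (x y : Ω) : ℝ := ‖F x - F y‖ ^ 2

/-- `d_T²(x, y)`, the average of `d²` along the two orbits over the delay window `[0, T]`. -/
def delaySqDist (Φ : Flow ℝ Ω) (F : Ω → Y) (T : ℝ) (x y : Ω) : ℝ :=
  (1 / T) * ∫ t in (0 : ℝ)..T, sqDist F (Φ t x) (Φ t y)

/-- The kernel `k_T = h ∘ d_T²`. -/
def delayKernel (Φ : Flow ℝ Ω) (F : Ω → Y) (h : ℝ → ℝ) (T : ℝ) (x y : Ω) : ℝ :=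
  h (delaySqDist Φ F T x y)

theorem delaySqDist_nonneg (Φ : Flow ℝ Ω) (F : Ω → Y) {T : ℝ} (hT : 0 < T) (x y : Ω) :
    0 ≤ delaySqDist Φ F T x y :=
  mul_nonneg (by positivity)
    (intervalIntegral.integral_nonneg hT.le fun _ _ => sq_nonneg _)

theorem continuous_delaySqDist (Φ : Flow ℝ Ω) {F : Ω → Y} (hF : Continuous F) (T : ℝ) :
    Continuous (fun p : Ω × Ω => delaySqDist Φ F T p.1 p.2) := by
  refine continuous_const.mul ?_
  refine intervalIntegral.continuous_parametric_intervalIntegral_of_continuous'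
    (f := fun (p : Ω × Ω) (t : ℝ) => sqDist F (Φ t p.1) (Φ t p.2)) ?_ 0 T
  have h1 : Continuous (fun q : (Ω × Ω) × ℝ => Φ q.2 q.1.1) :=
    Φ.continuous continuous_snd (continuous_fst.comp continuous_fst)
  have h2 : Continuous (fun q : (Ω × Ω) × ℝ => Φ q.2 q.1.2) :=
    Φ.continuous continuous_snd (continuous_snd.comp continuous_fst)
  exact (((hF.comp h1).sub (hF.comp h2)).norm).pow 2

theorem isBoundedKernel_delayKernel (Φ : Flow ℝ Ω) {F : Ω → Y} (hF : Continuous F) {h : ℝ → ℝ}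
    (hh : IsShapeFunction h) {T : ℝ} (hT : 0 < T) : IsBoundedKernel (delayKernel Φ F h T) where
  continuous :=
    hh.contDiffOn.continuousOn.comp_continuous (continuous_delaySqDist Φ hF T)
      fun p => delaySqDist_nonneg Φ F hT p.1 p.2
  bounded := by
    obtain ⟨C, hC⟩ := hh.bounded
    refine ⟨C, fun x y => ?_⟩
    have h0 := delaySqDist_nonneg Φ F hT x y
    unfold delayKernel
    rw [abs_of_pos (hh.pos _ h0)]
    exact hC _ h0

/-- The delay-coordinate kernel integral operator `K_T` on `L²(μ)`. -/
def delayOp [MeasurableSpace Ω] [BorelSpace Ω] (Φ : Flow ℝ Ω) (μ : Measure Ω)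
    [IsProbabilityMeasure μ] {F : Ω → Y} (hF : Continuous F) {h : ℝ → ℝ} (hh : IsShapeFunction h)
    {T : ℝ} (hT : 0 < T) : Lp ℂ 2 μ →L[ℂ] Lp ℂ 2 μ :=
  kernelOp μ (delayKernel Φ F h T) (isBoundedKernel_delayKernel Φ hF hh hT)

/-- The supremum norm of a function of two variables in `X`. -/
def supNormOn (X : Set Ω) (f : Ω → Ω → ℝ) : ℝ := ⨆ p : X × X, |f p.1 p.2|

/-- The semiflow on a forward-invariant set `M` (only its values at times `t ≥ 0` matter). -/
def restrictFlow (Φ : Flow ℝ Ω) (M : Set Ω) (hM : ∀ t : ℝ, 0 ≤ t → MapsTo (Φ t) M M) (t : ℝ) :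
    M → M :=
  (hM (max t 0) (le_max_right t 0)).restrict (Φ (max t 0)) M M

end Delay

/-! ### `C¹` norms on a manifold (possibly with boundary) -/

section C1

variable {E : Type*} [NormedAddCommGroup E] [NormedSpace ℝ E] {H : Type*} [TopologicalSpace H]
  (I : ModelWithCorners ℝ E H) {N : Type*} [TopologicalSpace N] [ChartedSpace H N]

/-- The derivative `df(v)` of a real function `f` along a tangent vector `v` at `x`. -/
def dirDeriv (f : N → ℝ) (x : N) (v : TangentSpace I x) : ℝ :=
  mfderiv I 𝓘(ℝ, ℝ) f x v

/-- The `C¹` norm of `f`, the maximum of `sup |f|` and `sup ‖df‖`, where the norm of the covector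
`df` at `x` is dual to the norm with the square `q x` on the tangent space. -/
def c1Norm (q : ∀ x : N, TangentSpace I x → ℝ) (f : N → ℝ) : ℝ :=
  max (⨆ x : N, |f x|)
    (⨆ v : {v : TangentBundle I N // q v.1 v.2 ≤ 1}, |dirDeriv I f v.1.1 v.1.2|)

variable {I} [IsManifold I 1 N]

/-- The square of the norm of a tangent vector. -/
def metricSq (g : Bundle.ContinuousRiemannianMetric E (fun x : N => TangentSpace I x)) (x : N)
    (v : TangentSpace I x) : ℝ :=
  g.inner x v v

/-- The square of the norm of a tangent vector `(v, w)` of `N × N` in the product metric. -/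
def prodMetricSq (g : Bundle.ContinuousRiemannianMetric E (fun x : N => TangentSpace I x))
    (p : N × N) (w : TangentSpace (I.prod I) p) : ℝ :=
  metricSq g p.1 (show E × E from w).1 + metricSq g p.2 (show E × E from w).2

/-- The norm of the operator `f ↦ df(v)` from `C¹(N)` to `C(N)`, where `v` is a vector field. -/
def vectorFieldNorm (g : Bundle.ContinuousRiemannianMetric E (fun x : N => TangentSpace I x))
    (v : ∀ x : N, TangentSpace I x) : ℝ :=
  sInf {c : ℝ | 0 ≤ c ∧ ∀ f : N → ℝ, ContMDiff I 𝓘(ℝ, ℝ) 1 f →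
    ∀ x : N, |dirDeriv I f x (v x)| ≤ c * c1Norm I (metricSq g) f}

end C1

end DelayCoherence

end

open DelayCoherence

noncomputable section

namespace DelayCoherence

section CompactSymmetric

variable {𝓗 : Type*} [NormedAddCommGroup 𝓗] [InnerProductSpace ℂ 𝓗] [CompleteSpace 𝓗]
  {K : 𝓗 →L[ℂ] 𝓗}

omit [CompleteSpace 𝓗] in
theorem mem_eigenspace {A : 𝓗 →L[ℂ] 𝓗} {u : ℝ} {f : 𝓗} :
    f ∈ eigenspace A u ↔ A f = (u : ℂ) • f := by
  simp [eigenspace]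

/-- A compact symmetric operator minus a real number is bounded below on the vectors which are
orthogonal to the eigenvectors with nearby eigenvalues. -/
theorem gap_mul_norm_le (hc : IsCompactOperator K) (hs : (K : 𝓗 →ₗ[ℂ] 𝓗).IsSymmetric)
    (a : ℝ) {γ : ℝ} (hγ : 0 ≤ γ) (w : 𝓗)
    (hw : ∀ u ∈ realPointSpectrum K, (∀ e ∈ eigenspace K u, inner ℂ e w = 0) ∨ γ ≤ |a - u|) :
    γ * ‖w‖ ≤ ‖K w - (a : ℂ) • w‖ := by
  have hO := hs.orthogonalFamily_eigenspaces
  have hcl : ∀ c : ℂ, IsClosed (Module.End.eigenspace (K : 𝓗 →ₗ[ℂ] 𝓗) c : Set 𝓗) := fun c => by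
    have : (Module.End.eigenspace (K : 𝓗 →ₗ[ℂ] 𝓗) c : Set 𝓗) = {x | K x = c • x} := by
      ext x; simp
    rw [this]
    exact isClosed_eq K.continuous (continuous_const_smul c)
  have hcomp : ∀ c : ℂ, CompleteSpace (Module.End.eigenspace (K : 𝓗 →ₗ[ℂ] 𝓗) c) :=
    fun c => (hcl c).completeSpace_coe
  have htot : ⊤ ≤ (⨆ c, Module.End.eigenspace (K : 𝓗 →ₗ[ℂ] 𝓗) c).topologicalClosure := by
    rw [top_le_iff, Submodule.topologicalClosure_eq_top_iff]
    exact ContinuousLinearMap.orthogonalComplement_iSup_eigenspaces_eq_bot hc hs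
  have hH := IsHilbertSum.mkInternal (fun c => Module.End.eigenspace (K : 𝓗 →ₗ[ℂ] 𝓗) c) hO htot
  obtain ⟨f, hsum⟩ : ∃ f : ∀ c : ℂ, Module.End.eigenspace (K : 𝓗 →ₗ[ℂ] 𝓗) c,
      HasSum (fun c => (f c : 𝓗)) w := by
    refine ⟨fun c => hH.linearIsometryEquiv w c, ?_⟩
    have := hH.hasSum_linearIsometryEquiv_symm (hH.linearIsometryEquiv w)
    rwa [LinearIsometryEquiv.symm_apply_apply] at this
  have hKf : ∀ i, K (f i) = i • (f i : 𝓗) := fun i =>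
    Module.End.mem_eigenspace_iff.mp (f i).2
  have hsum2 : HasSum (fun i : ℂ => ((i - a) • (f i : 𝓗))) (K w - (a : ℂ) • w) := by
    have := (hsum.mapL K).sub (hsum.const_smul (a : ℂ))
    simpa only [hKf, ← sub_smul] using this
  have hzero : ∀ i, γ * ‖f i‖ ≤ ‖(i - a) • f i‖ := by
    intro i
    by_cases h0 : f i = 0
    · simp [h0]
    have hev : Module.End.HasEigenvalue (K : 𝓗 →ₗ[ℂ] 𝓗) i :=
      Module.End.hasEigenvalue_of_hasEigenvector ⟨(f i).2, fun h => h0 (Subtype.ext h)⟩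
    have hre : ((i.re : ℝ) : ℂ) = i :=
      Complex.conj_eq_iff_re.mp (hs.conj_eigenvalue_eq_self hev)
    rw [norm_smul]
    refine mul_le_mul_of_nonneg_right ?_ (norm_nonneg _)
    rcases hw i.re (by rw [realPointSpectrum, mem_ofPred_eq, hre]; exact hev) with h | h
    · have h1 := h (f i) (by rw [eigenspace, hre]; exact (f i).2)
      have h2 : HasSum (fun j => inner ℂ (f i : 𝓗) (f j : 𝓗)) (inner ℂ (f i : 𝓗) w) :=
        hsum.mapL (innerSL ℂ (f i : 𝓗))
      have h3 := hasSum_single (f := fun j => inner ℂ (f i : 𝓗) (f j : 𝓗)) i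
        (fun j hj => hO hj.symm (f i) (f j))
      have h4 := h3.unique h2
      rw [h1] at h4
      exact absurd (Subtype.ext (inner_self_eq_zero.mp h4)) h0
    · rw [← hre, ← Complex.ofReal_sub, Complex.norm_real, Real.norm_eq_abs, abs_sub_comm]
      exact h
  have key : ∀ s : Finset ℂ, γ * ‖∑ i ∈ s, (f i : 𝓗)‖ ≤ ‖∑ i ∈ s, (i - a) • (f i : 𝓗)‖ := by
    intro s
    have h1 : ‖∑ i ∈ s, (f i : 𝓗)‖ ^ 2 = ∑ i ∈ s, ‖f i‖ ^ 2 := hO.norm_sum f s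
    have h2 : ‖∑ i ∈ s, (i - a) • (f i : 𝓗)‖ ^ 2 = ∑ i ∈ s, ‖(i - a) • f i‖ ^ 2 :=
      hO.norm_sum (fun i => (i - a) • f i) s
    refine le_of_sq_le_sq ?_ (norm_nonneg _)
    rw [mul_pow, h1, h2, Finset.mul_sum]
    refine Finset.sum_le_sum fun i _ => ?_
    rw [← mul_pow]
    exact pow_le_pow_left₀ (by positivity) (hzero i) 2
  exact le_of_tendsto_of_tendsto' (hsum.norm.const_mul γ) hsum2.norm key

omit [CompleteSpace 𝓗] in
theorem exists_pos_le_abs_sub (hc : IsCompactOperator K) (hs : (K : 𝓗 →ₗ[ℂ] 𝓗).IsSymmetric)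
    {a : ℝ} (ha : a ≠ 0) : ∃ ε > 0, ∀ u ∈ realPointSpectrum K, u ≠ a → ε ≤ |a - u| := by
  set W : Submodule ℂ 𝓗 := (Module.End.eigenspace (K : 𝓗 →ₗ[ℂ] 𝓗) (a : ℂ))ᗮ with hW
  have hinv : ∀ x ∈ W, K x ∈ W := hs.invariant_orthogonalComplement_eigenspace a
  let L : W →L[ℂ] W := (K.comp W.subtypeL).codRestrict W fun x => hinv x x.2
  have hcL : IsCompactOperator L :=
    (hc.comp_clm W.subtypeL).codRestrict (fun x => hinv x x.2) (Submodule.isClosed_orthogonal _)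
  have hL : ∀ x : W, ((L x : W) : 𝓗) = K x := fun _ => rfl
  have hne : ¬ Module.End.HasEigenvalue (L : W →ₗ[ℂ] W) (a : ℂ) := by
    intro h
    obtain ⟨x, hx⟩ := h.exists_hasEigenvector
    have h1 : K x = (a : ℂ) • (x : 𝓗) := by
      rw [← hL]
      exact congrArg Subtype.val hx.apply_eq_smul
    have h2 : (x : 𝓗) ∈ Module.End.eigenspace (K : 𝓗 →ₗ[ℂ] 𝓗) (a : ℂ) :=
      Module.End.mem_eigenspace_iff.mpr h1
    have h3 : inner ℂ (x : 𝓗) x = 0 := x.2 x h2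
    exact hx.2 (Subtype.ext (inner_self_eq_zero.mp h3))
  obtain ⟨C, hC⟩ := hcL.antilipschitz_of_not_hasEigenvalue (Complex.ofReal_ne_zero.mpr ha) hne
  refine ⟨(C + 1 : ℝ)⁻¹, by positivity, fun u hu hua => ?_⟩
  obtain ⟨w, hw⟩ := Module.End.HasEigenvalue.exists_hasEigenvector hu
  have hwW : w ∈ W := by
    intro e he
    exact hs.orthogonalFamily_eigenspaces.pairwise
      (Complex.ofReal_injective.ne hua) hw.1 _ he
  have h1 := hC.le_mul_dist ⟨w, hwW⟩ 0
  have h2 : (L - (a : ℂ) • 1) ⟨w, hwW⟩ = ((u : ℂ) - a) • (⟨w, hwW⟩ : W) := by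
    refine Subtype.ext ?_
    have : K w = (u : ℂ) • w := hw.apply_eq_smul
    simp [hL, this, sub_smul]
  rw [map_zero, dist_zero_right, dist_zero_right, h2, norm_smul, ← Complex.ofReal_sub,
    Complex.norm_real, Real.norm_eq_abs, abs_sub_comm, ← mul_assoc] at h1
  have hpos : 0 < ‖(⟨w, hwW⟩ : W)‖ := norm_pos_iff.mpr fun h => hw.2 (congrArg Subtype.val h)
  have h3 : 1 ≤ C * |a - u| := le_of_mul_le_mul_right (by simpa using h1) hpos
  rw [inv_le_iff_one_le_mul₀ (by positivity)]
  nlinarith [abs_nonneg (a - u)]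

theorem realPointSpectrum_diff_nonempty (hc : IsCompactOperator K)
    (hs : (K : 𝓗 →ₗ[ℂ] 𝓗).IsSymmetric) {a b : ℝ} {w : 𝓗} (hw0 : w ≠ 0)
    (ha : ∀ e ∈ eigenspace K a, inner ℂ e w = 0) (hb : ∀ e ∈ eigenspace K b, inner ℂ e w = 0) :
    (realPointSpectrum K \ {a, b}).Nonempty := by
  by_contra hne
  rw [not_nonempty_iff_eq_empty, sdiff_eq_empty] at hne
  have key : ∀ γ : ℝ, 0 ≤ γ → γ * ‖w‖ ≤ ‖K w - (a : ℂ) • w‖ := fun γ hγ =>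
    gap_mul_norm_le hc hs a hγ w fun u hu => by
      rcases hne hu with rfl | h
      · exact Or.inl ha
      · rw [mem_singleton_iff] at h
        exact Or.inl (h ▸ hb)
  have hpos : 0 < ‖w‖ := norm_pos_iff.mpr hw0
  have h1 := key (‖K w - (a : ℂ) • w‖ / ‖w‖ + 1) (by positivity)
  rw [add_mul, div_mul_cancel₀ _ hpos.ne', one_mul] at h1
  linarith

omit [CompleteSpace 𝓗] in
theorem spectralGap_pos (hc : IsCompactOperator K) (hs : (K : 𝓗 →ₗ[ℂ] 𝓗).IsSymmetric)
    {a b : ℝ} (ha : a ≠ 0) (hb : b ≠ 0) (hne : (realPointSpectrum K \ {a, b}).Nonempty) :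
    0 < spectralGap K a b := by
  obtain ⟨ε, hε, h1⟩ := exists_pos_le_abs_sub hc hs ha
  obtain ⟨η, hη, h2⟩ := exists_pos_le_abs_sub hc hs hb
  refine (lt_min hε hη).trans_le (le_csInf (hne.image _) ?_)
  rintro _ ⟨u, ⟨hu, hab⟩, rfl⟩
  rw [mem_insert_iff, mem_singleton_iff, not_or] at hab
  exact min_le_min (h1 u hu hab.1) (h2 u hu hab.2)

omit [CompleteSpace 𝓗] in
theorem spectralGap_le (K : 𝓗 →L[ℂ] 𝓗) (a b : ℝ) {u : ℝ} (hu : u ∈ realPointSpectrum K)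
    (ha : u ≠ a) (hb : u ≠ b) : spectralGap K a b ≤ min |a - u| |b - u| := by
  refine csInf_le ⟨0, ?_⟩ ⟨u, ⟨hu, by simp [ha, hb]⟩, rfl⟩
  rintro _ ⟨u, -, rfl⟩
  exact le_min (abs_nonneg _) (abs_nonneg _)

/-- The spectral gap bounds `A - b` from below on the orthogonal complement of the eigenspaces. -/
theorem spectralGap_mul_norm_le (hc : IsCompactOperator K) (hs : (K : 𝓗 →ₗ[ℂ] 𝓗).IsSymmetric)
    {a b : ℝ} (hγ : 0 ≤ spectralGap K a b) {w : 𝓗}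
    (ha : ∀ e ∈ eigenspace K a, inner ℂ e w = 0) (hb : ∀ e ∈ eigenspace K b, inner ℂ e w = 0) :
    spectralGap K a b * ‖w‖ ≤ ‖K w - (b : ℂ) • w‖ := by
  refine gap_mul_norm_le hc hs b hγ w fun u hu => ?_
  by_cases hua : u = a
  · exact Or.inl (hua ▸ ha)
  by_cases hub : u = b
  · exact Or.inl (hub ▸ hb)
  · exact Or.inr ((spectralGap_le K a b hu hua hub).trans (min_le_right _ _))

end CompactSymmetric

section UnitaryGroup

variable {𝓗 : Type*} [NormedAddCommGroup 𝓗] [InnerProductSpace ℂ 𝓗]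
  {U : ℝ → 𝓗 →ₗᵢ[ℂ] 𝓗}

theorem hasDerivAt_orbit (hU : ∀ s t f, U (s + t) f = U s (U t f)) {f f' : 𝓗}
    (h : HasDerivAt (fun t => U t f) f' 0) (t : ℝ) :
    HasDerivAt (fun s => U s f) (U t f') t := by
  have h1 : HasDerivAt (fun s => U (s - t) f) f' t := by
    have h2 : HasDerivAt (fun s => U s f) f' (t - t) := by rwa [sub_self]
    simpa using h2.comp_sub_const t t
  have h3 := ((U t).toContinuousLinearMap.restrictScalars ℝ).hasFDerivAt.comp_hasDerivAt t h1
  refine h3.congr_of_eventuallyEq (Filter.Eventually.of_forall fun s => ?_)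
  simp [← hU]

theorem inner_deriv_add_inner_deriv_eq_zero (hU0 : ∀ f, U 0 f = f) {f g f' g' : 𝓗}
    (hf : HasDerivAt (fun t => U t f) f' 0) (hg : HasDerivAt (fun t => U t g) g' 0) :
    inner ℂ f g' + inner ℂ f' g = 0 := by
  have h1 := hf.inner ℂ hg
  simp only [hU0, LinearIsometry.inner_map_map] at h1
  exact h1.unique (hasDerivAt_const 0 _)

theorem norm_sub_exp_mul_le {y g : ℝ → ℂ} {b : ℝ → ℝ} (κ : ℝ)
    (hy : ∀ t, HasDerivAt y (Complex.I * κ * y t + g t) t) (hg : ∀ t, 0 ≤ t → ‖g t‖ ≤ b t)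
    (hb : Continuous b) {t : ℝ} (ht : 0 ≤ t) :
    ‖y t - Complex.exp (Complex.I * κ * t) * y 0‖ ≤ ∫ u in (0 : ℝ)..t, b u := by
  have hE : ∀ s : ℝ, HasDerivAt (fun s : ℝ => Complex.exp (-(Complex.I * κ * s)))
      (Complex.exp (-(Complex.I * κ * s)) * (-(Complex.I * κ))) s := fun s => by
    have h1 : HasDerivAt (fun s : ℝ => -(Complex.I * κ * (s : ℂ))) (-(Complex.I * κ)) s := by
      simpa using ((Complex.ofRealCLM.hasDerivAt (x := s)).const_mul (Complex.I * κ)).fun_neg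
    exact h1.cexp
  have hn : ∀ s : ℝ, ‖Complex.exp (-(Complex.I * κ * s))‖ = 1 := fun s => by
    rw [show -(Complex.I * κ * s) = ((-(κ * s) : ℝ) : ℂ) * Complex.I by push_cast; ring]
    exact Complex.norm_exp_ofReal_mul_I _
  have hd : ∀ s : ℝ, HasDerivAt (fun s : ℝ => Complex.exp (-(Complex.I * κ * s)) * y s - y 0)
      (Complex.exp (-(Complex.I * κ * s)) * g s) s := fun s => by
    refine (((hE s).mul (hy s)).sub_const (y 0)).congr_deriv ?_
    ring
  have hB : ∀ s : ℝ, HasDerivAt (fun s => ∫ u in (0 : ℝ)..s, b u) (b s) s := fun s =>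
    intervalIntegral.integral_hasDerivAt_right (hb.intervalIntegrable _ _)
      (hb.stronglyMeasurableAtFilter _ _) hb.continuousAt
  have h1 := image_norm_le_of_norm_deriv_right_le_deriv_boundary (a := 0) (b := t)
    (fun s _ => (hd s).continuousAt.continuousWithinAt) (fun s _ => (hd s).hasDerivWithinAt)
    (by simp) hB (fun s hs => by rw [norm_mul, hn, one_mul]; exact hg s hs.1)
    (right_mem_Icc.mpr ht)
  refine le_of_eq_of_le ?_ h1
  rw [← one_mul ‖y t - _‖, ← hn t, ← norm_mul, mul_sub, ← mul_assoc, ← Complex.exp_add]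
  simp

theorem norm_inner_orbit_sub_le (hU0 : ∀ f, U 0 f = f) (hU : ∀ s t f, U (s + t) f = U s (U t f))
    {e e' z z' : 𝓗} (he : HasDerivAt (fun t => U t e) e' 0)
    (hz : HasDerivAt (fun t => U t z) z' 0) (κ : ℝ) {b : ℝ → ℝ} (hb : Continuous b)
    (h : ∀ t, 0 ≤ t → ‖inner ℂ e' (U t z) + Complex.I * κ * inner ℂ e (U t z)‖ ≤ b t)
    {t : ℝ} (ht : 0 ≤ t) :
    ‖inner ℂ e (U t z) - Complex.exp (Complex.I * κ * t) * inner ℂ e z‖ ≤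
      ∫ u in (0 : ℝ)..t, b u := by
  have hd : ∀ t, HasDerivAt (fun t => inner ℂ e (U t z)) (Complex.I * κ * inner ℂ e (U t z) +
      -(inner ℂ e' (U t z) + Complex.I * κ * inner ℂ e (U t z))) t := fun t => by
    have h1 := hasDerivAt_orbit hU hz t
    have h2 : HasDerivAt (fun s => U s (U t z)) (U t z') 0 := by
      have h4 : HasDerivAt (fun s => U s z) (U t z') (0 + t) := by rwa [zero_add]
      simpa [hU] using h4.comp_add_const 0 t
    have h3 := inner_deriv_add_inner_deriv_eq_zero hU0 he h2
    refine ((hasDerivAt_const t e).inner ℂ h1).congr_deriv ?_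
    rw [inner_zero_left]
    linear_combination h3
  have h1 := norm_sub_exp_mul_le κ hd (fun t ht => by rw [norm_neg]; exact h t ht) hb ht
  simpa only [hU0] using h1

end UnitaryGroup

section Plane

variable {𝓗 : Type*} [NormedAddCommGroup 𝓗] [InnerProductSpace ℂ 𝓗]

theorem one_div_sqrt_two_mul_self :
    (1 / (Real.sqrt 2 : ℂ)) * (1 / (Real.sqrt 2 : ℂ)) = 1 / 2 := by
  rw [div_mul_div_comm, one_mul, ← Complex.ofReal_mul, Real.mul_self_sqrt zero_le_two]
  norm_num

theorem norm_sub_inner_smul_le {e : 𝓗} (he : ‖e‖ = 1) (q : 𝓗) :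
    ‖q - (inner ℂ e q : ℂ) • e‖ ≤ ‖q‖ := by
  have h1 : inner ℂ (q - (inner ℂ e q : ℂ) • e) ((inner ℂ e q : ℂ) • e) = 0 := by
    rw [inner_smul_right, inner_sub_left, inner_smul_left, inner_self_eq_norm_sq_to_K, he]
    simp
  have h2 := norm_add_sq_eq_norm_sq_add_norm_sq_of_inner_eq_zero _ _ h1
  rw [sub_add_cancel] at h2
  nlinarith [norm_nonneg q, norm_nonneg (q - (inner ℂ e q : ℂ) • e),
    norm_nonneg ((inner ℂ e q : ℂ) • e)]

theorem exists_eq_add_of_mem_eigenspace_sup {K : 𝓗 →L[ℂ] 𝓗} {lam nu : ℝ} {φ ψ : 𝓗}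
    (hsimple : lam ≠ nu →
      Module.finrank ℂ (eigenspace K lam) = 1 ∧ Module.finrank ℂ (eigenspace K nu) = 1)
    (hdouble : lam = nu → Module.finrank ℂ (eigenspace K lam) = 2)
    (hφ : φ ∈ eigenspace K lam) (hψ : ψ ∈ eigenspace K nu)
    (hφ1 : ‖φ‖ = 1) (hψ1 : ‖ψ‖ = 1) (hφψ : inner ℂ φ ψ = 0) {e : 𝓗}
    (he : e ∈ eigenspace K lam ⊔ eigenspace K nu) : ∃ a b : ℂ, e = a • φ + b • ψ := by
  have hφ0 : φ ≠ 0 := norm_ne_zero_iff.mp (by rw [hφ1]; exact one_ne_zero)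
  have hψ0 : ψ ≠ 0 := norm_ne_zero_iff.mp (by rw [hψ1]; exact one_ne_zero)
  by_cases h : lam = nu
  · subst h
    rw [sup_idem] at he
    have hli : LinearIndependent ℂ ![φ, ψ] := by
      refine linearIndependent_of_ne_zero_of_inner_eq_zero (𝕜 := ℂ) ?_ ?_
      · intro i; fin_cases i <;> simp [hφ0, hψ0]
      · intro i j hij
        fin_cases i <;> fin_cases j <;> simp_all [inner_eq_zero_symm.mp hφψ]
    have hfr := finrank_span_eq_card hli
    have : FiniteDimensional ℂ (eigenspace K lam) :=
      FiniteDimensional.of_finrank_pos (by rw [hdouble rfl]; norm_num)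
    have hle : Submodule.span ℂ (range ![φ, ψ]) ≤ eigenspace K lam := by
      rw [Submodule.span_le]
      rintro _ ⟨i, rfl⟩
      fin_cases i <;> simp [hφ, hψ]
    have heq := Submodule.eq_of_le_of_finrank_eq hle (by rw [hfr, hdouble rfl]; rfl)
    rw [← heq, Matrix.range_cons, Matrix.range_cons, Matrix.range_empty, union_empty,
      singleton_union, Submodule.mem_span_pair] at he
    obtain ⟨a, b, h⟩ := he
    exact ⟨a, b, h.symm⟩
  · obtain ⟨h1, h2⟩ := hsimple h
    obtain ⟨x, hx, y, hy, rfl⟩ := Submodule.mem_sup.mp he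
    obtain ⟨a, ha⟩ := (finrank_eq_one_iff_of_nonzero' (⟨φ, hφ⟩ : eigenspace K lam)
      (fun h => hφ0 (congrArg Subtype.val h))).mp h1 ⟨x, hx⟩
    obtain ⟨b, hb⟩ := (finrank_eq_one_iff_of_nonzero' (⟨ψ, hψ⟩ : eigenspace K nu)
      (fun h => hψ0 (congrArg Subtype.val h))).mp h2 ⟨y, hy⟩
    exact ⟨a, b, congrArg₂ (· + ·) (congrArg Subtype.val ha).symm (congrArg Subtype.val hb).symm⟩

/-- The component of `u` off the plane spanned by two eigenvectors is controlled by `(K - ν) u`. -/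
theorem spectralGap_mul_norm_sub_le [CompleteSpace 𝓗] {K : 𝓗 →L[ℂ] 𝓗} (hc : IsCompactOperator K)
    (hs : (K : 𝓗 →ₗ[ℂ] 𝓗).IsSymmetric) {lam nu : ℝ} (hγ : 0 ≤ spectralGap K lam nu) {φ ψ : 𝓗}
    (hφ : φ ∈ eigenspace K lam) (hψ : ψ ∈ eigenspace K nu)
    (hφ1 : ‖φ‖ = 1) (hψ1 : ‖ψ‖ = 1) (hφψ : inner ℂ φ ψ = 0)
    (hspan : ∀ e ∈ eigenspace K lam ⊔ eigenspace K nu, ∃ a b : ℂ, e = a • φ + b • ψ) (u : 𝓗) :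
    spectralGap K lam nu * ‖u - (inner ℂ φ u : ℂ) • φ - (inner ℂ ψ u : ℂ) • ψ‖ ≤
      ‖K u - (nu : ℂ) • u‖ := by
  rw [mem_eigenspace] at hφ hψ
  have hψφ : inner ℂ ψ φ = 0 := inner_eq_zero_symm.mp hφψ
  set r := u - (inner ℂ φ u : ℂ) • φ - (inner ℂ ψ u : ℂ) • ψ with hr
  have hrφ : inner ℂ φ r = 0 := by
    simp [hr, inner_self_eq_norm_sq_to_K, hφ1, hφψ]
  have hrψ : inner ℂ ψ r = 0 := by
    simp [hr, inner_self_eq_norm_sq_to_K, hψ1, hψφ]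
  have hrE : ∀ e ∈ eigenspace K lam ⊔ eigenspace K nu, inner ℂ e r = 0 := fun e he => by
    obtain ⟨a, b, rfl⟩ := hspan e he
    simp [hrφ, hrψ]
  refine (spectralGap_mul_norm_le hc hs hγ (fun e he => hrE e (Submodule.mem_sup_left he))
    fun e he => hrE e (Submodule.mem_sup_right he)).trans ?_
  have hq : inner ℂ φ (K u - (nu : ℂ) • u) = ((lam : ℂ) - nu) * inner ℂ φ u := by
    have h1 : inner ℂ φ (K u) = inner ℂ (K φ) u := (hs φ u).symm
    rw [inner_sub_right, h1, hφ, inner_smul_left, inner_smul_right, Complex.conj_ofReal, sub_mul]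
  have h2 : K r - (nu : ℂ) • r =
      (K u - (nu : ℂ) • u) - (inner ℂ φ (K u - (nu : ℂ) • u) : ℂ) • φ := by
    rw [hq, hr, map_sub, map_sub, map_smul, map_smul, hφ, hψ]
    module
  rw [h2]
  exact norm_sub_inner_smul_le hφ1 _

end Plane

section CoherentPair

variable {𝓗 : Type*} [NormedAddCommGroup 𝓗] [InnerProductSpace ℂ 𝓗]

/-- The combination `(φ + i ψ) / √2`. -/
def complexify (φ ψ : 𝓗) : 𝓗 := (1 / (Real.sqrt 2 : ℂ)) • (φ + Complex.I • ψ)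

theorem inner_complexify_left (φ ψ u : 𝓗) : inner ℂ (complexify φ ψ) u =
    (1 / (Real.sqrt 2 : ℂ)) * (inner ℂ φ u - Complex.I * inner ℂ ψ u) := by
  simp [complexify, sub_eq_add_neg]
  ring

theorem inner_complexify_right (φ ψ u : 𝓗) : inner ℂ u (complexify φ ψ) =
    (1 / (Real.sqrt 2 : ℂ)) * (inner ℂ u φ + Complex.I * inner ℂ u ψ) := by
  simp [complexify]
  ring

theorem inner_complexify_complexify (a b c d : 𝓗) :
    inner ℂ (complexify a b) (complexify c d) =
      1 / 2 * (inner ℂ a c + inner ℂ b d + Complex.I * (inner ℂ a d - inner ℂ b c)) := by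
  rw [inner_complexify_left, inner_complexify_right, inner_complexify_right,
    ← one_div_sqrt_two_mul_self]
  linear_combination (-(1 / (Real.sqrt 2 : ℂ)) * (1 / (Real.sqrt 2 : ℂ)) * inner ℂ b d) *
    Complex.I_mul_I

theorem inner_smul_complexify_add (φ ψ u : 𝓗) :
    (inner ℂ (complexify φ ψ) u : ℂ) • complexify φ ψ +
      (inner ℂ (complexify φ (-ψ)) u : ℂ) • complexify φ (-ψ) =
      (inner ℂ φ u : ℂ) • φ + (inner ℂ ψ u : ℂ) • ψ := by
  rw [inner_complexify_left, inner_complexify_left, complexify, complexify, inner_neg_left]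
  have h := one_div_sqrt_two_mul_self
  generalize (1 / (Real.sqrt 2 : ℂ)) = c at h ⊢
  match_scalars
  · linear_combination (2 * inner ℂ φ u) * h
  · linear_combination (-2 * Complex.I ^ 2 * inner ℂ ψ u) * h - inner ℂ ψ u * Complex.I_sq

theorem norm_complexify {φ ψ : 𝓗} (hφ1 : ‖φ‖ = 1) (hψ1 : ‖ψ‖ = 1) (hφψ : inner ℂ φ ψ = 0) :
    ‖complexify φ ψ‖ = 1 := by
  have h : inner ℂ (complexify φ ψ) (complexify φ ψ) = (1 : ℂ) := by
    rw [inner_complexify_complexify, hφψ, inner_eq_zero_symm.mp hφψ,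
      inner_self_eq_norm_sq_to_K, inner_self_eq_norm_sq_to_K, hφ1, hψ1]
    norm_num
  rw [inner_self_eq_norm_sq_to_K] at h
  have h2 : ‖complexify φ ψ‖ ^ 2 = 1 := Complex.ofReal_injective (by simpa using h)
  nlinarith [norm_nonneg (complexify φ ψ)]

theorem norm_complexify_le {a b : 𝓗} {B : ℝ} (ha : ‖a‖ ≤ B) (hb : ‖b‖ ≤ B) :
    ‖complexify a b‖ ≤ 2 * B := by
  have h1 : ‖(1 / (Real.sqrt 2 : ℂ))‖ ≤ 1 := by
    rw [norm_div, norm_one, Complex.norm_real, Real.norm_of_nonneg (Real.sqrt_nonneg 2)]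
    exact div_le_one_of_le₀ (Real.one_le_sqrt.mpr one_le_two) (Real.sqrt_nonneg 2)
  have h2 : ‖a + Complex.I • b‖ ≤ 2 * B := by
    refine (norm_add_le _ _).trans ?_
    rw [norm_smul, Complex.norm_I, one_mul]
    linarith
  rw [complexify, norm_smul]
  exact (mul_le_of_le_one_left (norm_nonneg _) h1).trans h2

theorem hasDerivAt_complexify {U : ℝ → 𝓗 →ₗᵢ[ℂ] 𝓗} {φ ψ φ' ψ' : 𝓗}
    (hφ : HasDerivAt (fun t => U t φ) φ' 0) (hψ : HasDerivAt (fun t => U t ψ) ψ' 0) :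
    HasDerivAt (fun t => U t (complexify φ ψ)) (complexify φ' ψ') 0 := by
  simp only [complexify, map_smul, map_add]
  exact (hφ.fun_add (hψ.fun_const_smul Complex.I)).fun_const_smul _

theorem hasDerivAt_neg_orbit {U : ℝ → 𝓗 →ₗᵢ[ℂ] 𝓗} {ψ ψ' : 𝓗}
    (hψ : HasDerivAt (fun t => U t ψ) ψ' 0) : HasDerivAt (fun t => U t (-ψ)) (-ψ') 0 := by
  simp only [map_neg]
  exact hψ.fun_neg

theorem norm_apply_complexify_sub {K : 𝓗 →L[ℂ] 𝓗} {lam nu : ℝ} (hlamnu : lam ≤ nu) {φ ψ : 𝓗}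
    (hφ : φ ∈ eigenspace K lam) (hψ : ψ ∈ eigenspace K nu) (hφ1 : ‖φ‖ = 1) :
    ‖K (complexify φ ψ) - (nu : ℂ) • complexify φ ψ‖ = 1 / Real.sqrt 2 * (nu - lam) := by
  rw [mem_eigenspace] at hφ hψ
  have h1 : K (complexify φ ψ) - (nu : ℂ) • complexify φ ψ =
      ((1 / (Real.sqrt 2 : ℂ)) * ((lam - nu : ℝ) : ℂ)) • φ := by
    rw [complexify, map_smul, map_add, map_smul, hφ, hψ]
    push_cast
    module
  rw [h1, norm_smul, hφ1, mul_one, norm_mul, norm_div, norm_one, Complex.norm_real,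
    Complex.norm_real, Real.norm_of_nonneg (Real.sqrt_nonneg 2), Real.norm_eq_abs, abs_sub_comm,
    abs_of_nonneg (sub_nonneg.mpr hlamnu)]

/-- The data of a unitary group and of a pair of orthonormal eigenvectors of a compact symmetric
operator which nearly commutes with the group, with the values of the generator on the plane
spanned by them. -/
structure IsCoherentPair (U : ℝ → 𝓗 →ₗᵢ[ℂ] 𝓗) (K : 𝓗 →L[ℂ] 𝓗) (lam nu : ℝ) (φ ψ φ' ψ' : 𝓗)
    (ω : ℝ) : Prop where
  map_zero : ∀ f, U 0 f = f
  map_add : ∀ s t f, U (s + t) f = U s (U t f)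
  isCompact : IsCompactOperator K
  isSymmetric : (K : 𝓗 →ₗ[ℂ] 𝓗).IsSymmetric
  le : lam ≤ nu
  gap_pos : 0 < spectralGap K lam nu
  mem_left : φ ∈ eigenspace K lam
  mem_right : ψ ∈ eigenspace K nu
  norm_left : ‖φ‖ = 1
  norm_right : ‖ψ‖ = 1
  inner_eq_zero : inner ℂ φ ψ = 0
  span : ∀ e ∈ eigenspace K lam ⊔ eigenspace K nu, ∃ a b : ℂ, e = a • φ + b • ψ
  deriv_left : HasDerivAt (fun t => U t φ) φ' 0
  deriv_right : HasDerivAt (fun t => U t ψ) ψ' 0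
  inner_left_left : inner ℂ φ φ' = 0
  inner_right_right : inner ℂ ψ ψ' = 0
  inner_left_right : inner ℂ φ ψ' = (ω : ℂ)
  inner_right_left : inner ℂ ψ φ' = -(ω : ℂ)

namespace IsCoherentPair

variable {U : ℝ → 𝓗 →ₗᵢ[ℂ] 𝓗} {K : 𝓗 →L[ℂ] 𝓗} {lam nu : ℝ} {φ ψ φ' ψ' : 𝓗} {ω : ℝ}

theorem inner_complexify_deriv (h : IsCoherentPair U K lam nu φ ψ φ' ψ' ω) :
    inner ℂ (complexify φ ψ) (complexify φ' ψ') = Complex.I * ω := by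
  rw [inner_complexify_complexify, h.inner_left_left, h.inner_right_right, h.inner_left_right,
    h.inner_right_left]
  ring

theorem inner_swap (h : IsCoherentPair U K lam nu φ ψ φ' ψ' ω) :
    inner ℂ φ' φ = 0 ∧ inner ℂ ψ' ψ = 0 ∧ inner ℂ ψ' φ = (ω : ℂ) ∧ inner ℂ φ' ψ = -(ω : ℂ) := by
  refine ⟨inner_eq_zero_symm.mp h.inner_left_left, inner_eq_zero_symm.mp h.inner_right_right, ?_,
    ?_⟩
  · rw [← inner_conj_symm, h.inner_left_right, Complex.conj_ofReal]
  · rw [← inner_conj_symm, h.inner_right_left, _root_.map_neg, Complex.conj_ofReal]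

variable [CompleteSpace 𝓗] {c : ℝ}

theorem norm_remainder_le (h : IsCoherentPair U K lam nu φ ψ φ' ψ' ω)
    (hK : ∀ t, 0 ≤ t → ∀ f, ‖U t (K f) - K (U t f)‖ ≤ c * t * ‖f‖) {t : ℝ} (ht : 0 ≤ t) :
    ‖U t (complexify φ ψ) - ((inner ℂ (complexify φ ψ) (U t (complexify φ ψ)) : ℂ) •
      complexify φ ψ + (inner ℂ (complexify φ (-ψ)) (U t (complexify φ ψ)) : ℂ) •
      complexify φ (-ψ))‖ ≤
      1 / spectralGap K lam nu * (c * t + 1 / Real.sqrt 2 * (nu - lam)) := by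
  set z := complexify φ ψ with hz
  rw [inner_smul_complexify_add, ← sub_sub, one_div_mul_eq_div, le_div_iff₀ h.gap_pos, mul_comm]
  refine (spectralGap_mul_norm_sub_le h.isCompact h.isSymmetric h.gap_pos.le h.mem_left
    h.mem_right h.norm_left h.norm_right h.inner_eq_zero h.span _).trans ?_
  have h1 : K (U t z) - (nu : ℂ) • U t z =
      U t (K z - (nu : ℂ) • z) - (U t (K z) - K (U t z)) := by
    rw [_root_.map_sub, map_smul]
    abel
  have hz1 : ‖z‖ = 1 := norm_complexify h.norm_left h.norm_right h.inner_eq_zero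
  have h2 := hK t ht z
  rw [hz1, mul_one] at h2
  rw [h1, add_comm]
  refine (norm_sub_le _ _).trans (add_le_add ?_ h2)
  rw [LinearIsometry.norm_map, norm_apply_complexify_sub h.le h.mem_left h.mem_right h.norm_left]

omit [CompleteSpace 𝓗] in
theorem norm_inner_sub_le (h : IsCoherentPair U K lam nu φ ψ φ' ψ' ω)
    {s : ℝ → ℝ} (hs : Continuous s)
    (hr : ∀ t, 0 ≤ t → ‖U t (complexify φ ψ) -
      ((inner ℂ (complexify φ ψ) (U t (complexify φ ψ)) : ℂ) • complexify φ ψ +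
      (inner ℂ (complexify φ (-ψ)) (U t (complexify φ ψ)) : ℂ) • complexify φ (-ψ))‖ ≤ s t)
    {B : ℝ} (hB : 0 ≤ B) (hφ' : ‖φ'‖ ≤ B) (hψ' : ‖ψ'‖ ≤ B) {t : ℝ} (ht : 0 ≤ t) :
    ‖inner ℂ (complexify φ ψ) (U t (complexify φ ψ)) - Complex.exp (Complex.I * ω * t)‖ ≤
        2 * B * ∫ u in (0 : ℝ)..t, s u ∧
    ‖inner ℂ (complexify φ (-ψ)) (U t (complexify φ ψ))‖ ≤ 2 * B * ∫ u in (0 : ℝ)..t, s u := by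
  obtain ⟨h1, h2, h3, h4⟩ := h.inner_swap
  have hdz := hasDerivAt_complexify h.deriv_left h.deriv_right
  have hdw := hasDerivAt_complexify h.deriv_left (hasDerivAt_neg_orbit h.deriv_right)
  have key : ∀ e e' : 𝓗, ‖e'‖ ≤ 2 * B → HasDerivAt (fun t => U t e) e' 0 → ∀ κ : ℝ,
      (∀ t, (inner ℂ (complexify φ ψ) (U t (complexify φ ψ)) : ℂ) * inner ℂ e' (complexify φ ψ) +
        inner ℂ (complexify φ (-ψ)) (U t (complexify φ ψ)) * inner ℂ e' (complexify φ (-ψ)) =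
        -(Complex.I * κ * inner ℂ e (U t (complexify φ ψ)))) →
      ‖inner ℂ e (U t (complexify φ ψ)) -
        Complex.exp (Complex.I * κ * t) * inner ℂ e (complexify φ ψ)‖ ≤
        2 * B * ∫ u in (0 : ℝ)..t, s u := by
    intro e e' he' he κ hk
    rw [← intervalIntegral.integral_const_mul]
    refine norm_inner_orbit_sub_le h.map_zero h.map_add he hdz κ (hs.const_mul (2 * B)) ?_ ht
    intro t ht
    have h5 : inner ℂ e' (U t (complexify φ ψ)) +
        Complex.I * κ * inner ℂ e (U t (complexify φ ψ)) =
        inner ℂ e' (U t (complexify φ ψ) -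
      ((inner ℂ (complexify φ ψ) (U t (complexify φ ψ)) : ℂ) • complexify φ ψ +
      (inner ℂ (complexify φ (-ψ)) (U t (complexify φ ψ)) : ℂ) • complexify φ (-ψ))) := by
      rw [inner_sub_right, inner_add_right, inner_smul_right, inner_smul_right, hk t]
      ring
    rw [h5]
    exact (norm_inner_le_norm _ _).trans (mul_le_mul he' (hr t ht) (norm_nonneg _) (by positivity))
  constructor
  · have h6 := key _ _ (norm_complexify_le hφ' hψ') hdz ω fun t => by
      rw [inner_complexify_complexify φ' ψ' φ ψ, inner_complexify_complexify φ' ψ' φ (-ψ)]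
      simp only [inner_neg_right, h1, h2, h3, h4]
      ring
    rwa [inner_self_eq_norm_sq_to_K, norm_complexify h.norm_left h.norm_right h.inner_eq_zero,
      RCLike.ofReal_one, one_pow, mul_one] at h6
  · have h6 := key _ _ (norm_complexify_le hφ' (by rwa [norm_neg])) hdw (-ω) fun t => by
      rw [inner_complexify_complexify φ' (-ψ') φ ψ, inner_complexify_complexify φ' (-ψ') φ (-ψ)]
      simp only [inner_neg_right, inner_neg_left, h1, h2, h3, h4]
      push_cast
      ring
    have h7 : inner ℂ (complexify φ (-ψ)) (complexify φ ψ) = 0 := by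
      rw [inner_complexify_complexify, inner_neg_left, inner_neg_left, h.inner_eq_zero,
        inner_eq_zero_symm.mp h.inner_eq_zero, inner_self_eq_norm_sq_to_K,
        inner_self_eq_norm_sq_to_K, h.norm_left, h.norm_right]
      simp
    rwa [h7, mul_zero, sub_zero] at h6

theorem le_sqrt_of_le_one {x S : ℝ} (hx : x ≤ S) (hx1 : x ≤ 1) : x ≤ Real.sqrt S := by
  rcases le_total S 1 with h | h
  · rcases le_total x 0 with h0 | h0
    · exact h0.trans (Real.sqrt_nonneg S)
    · exact Real.le_sqrt_of_sq_le (by nlinarith)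
  · exact hx1.trans (Real.one_le_sqrt.mpr h)

theorem approx_eigenfunction (h : IsCoherentPair U K lam nu φ ψ φ' ψ' ω)
    (hK : ∀ t, 0 ≤ t → ∀ f, ‖U t (K f) - K (U t f)‖ ≤ c * t * ‖f‖)
    {B : ℝ} (hB : 0 ≤ B) (hφ' : ‖φ'‖ ≤ B) (hψ' : ‖ψ'‖ ≤ B) {s : ℝ → ℝ} (hs : Continuous s)
    (hcs : ∀ t, 0 ≤ t →
      1 / spectralGap K lam nu * (c * t + 1 / Real.sqrt 2 * (nu - lam)) ≤ s t)
    {t S : ℝ} (ht : 0 ≤ t) (hS : 2 * B * ∫ u in (0 : ℝ)..t, s u ≤ S) :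
    ‖U t (complexify φ ψ) - (inner ℂ (complexify φ ψ) (U t (complexify φ ψ)) : ℂ) •
      complexify φ ψ‖ ≤ s t + Real.sqrt S ∧
    ‖inner ℂ (complexify φ ψ) (U t (complexify φ ψ)) - Complex.exp (Complex.I * ω * t)‖ ≤
      2 * Real.sqrt S := by
  have hr := fun t ht => (h.norm_remainder_le hK ht).trans (hcs t ht)
  obtain ⟨h1, h2⟩ := h.norm_inner_sub_le hs hr hB hφ' hψ' ht
  have hz1 : ‖complexify φ ψ‖ = 1 := norm_complexify h.norm_left h.norm_right h.inner_eq_zero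
  have hw1 : ‖complexify φ (-ψ)‖ = 1 := norm_complexify h.norm_left
    (by rw [norm_neg, h.norm_right]) (by rw [inner_neg_right, h.inner_eq_zero, neg_zero])
  have hone : ∀ e : 𝓗, ‖e‖ = 1 → ‖inner ℂ e (U t (complexify φ ψ))‖ ≤ 1 := fun e he => by
    refine (norm_inner_le_norm _ _).trans ?_
    rw [LinearIsometry.norm_map, hz1, he, one_mul]
  constructor
  · have h3 := hr t ht
    rw [← sub_sub] at h3
    have h4 := norm_le_norm_sub_add (U t (complexify φ ψ) -
      (inner ℂ (complexify φ ψ) (U t (complexify φ ψ)) : ℂ) • complexify φ ψ)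
      ((inner ℂ (complexify φ (-ψ)) (U t (complexify φ ψ)) : ℂ) • complexify φ (-ψ))
    refine h4.trans (add_le_add h3 ?_)
    rw [norm_smul, hw1, mul_one]
    exact le_sqrt_of_le_one (h2.trans hS) (hone _ hw1)
  · have h3 : ‖Complex.exp (Complex.I * ω * t)‖ = 1 := by
      rw [show Complex.I * ω * t = ((ω * t : ℝ) : ℂ) * Complex.I by push_cast; ring]
      exact Complex.norm_exp_ofReal_mul_I _
    have h4 := norm_sub_le (inner ℂ (complexify φ ψ) (U t (complexify φ ψ)))
      (Complex.exp (Complex.I * ω * t))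
    have h5 := hone _ hz1
    have h6 := h1.trans hS
    have h7 : ‖inner ℂ (complexify φ ψ) (U t (complexify φ ψ)) -
      Complex.exp (Complex.I * ω * t)‖ / 2 ≤ Real.sqrt S :=
      le_sqrt_of_le_one (by linarith [norm_nonneg (inner ℂ (complexify φ ψ)
        (U t (complexify φ ψ)) - Complex.exp (Complex.I * ω * t))]) (by linarith)
    linarith

omit [CompleteSpace 𝓗] in
/-- The rotation frequency does not depend on the real orthonormal basis of the plane. -/
theorem norm_inner_deriv_eq (h : IsCoherentPair U K lam nu φ ψ φ' ψ' ω) {a b c d : ℝ}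
    (hab : ‖(a : ℂ) • φ + (b : ℂ) • ψ‖ = 1) (hcd : ‖(c : ℂ) • φ + (d : ℂ) • ψ‖ = 1)
    (hi : inner ℂ ((a : ℂ) • φ + (b : ℂ) • ψ) ((c : ℂ) • φ + (d : ℂ) • ψ) = 0) :
    ‖inner ℂ ((c : ℂ) • φ + (d : ℂ) • ψ) ((a : ℂ) • φ' + (b : ℂ) • ψ')‖ = |ω| := by
  have hin : ∀ a b c d : ℝ,
      inner ℂ ((a : ℂ) • φ + (b : ℂ) • ψ) ((c : ℂ) • φ + (d : ℂ) • ψ) =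
        ((a * c + b * d : ℝ) : ℂ) := by
    intro a b c d
    simp only [inner_add_left, inner_add_right, inner_smul_left, inner_smul_right,
      h.inner_eq_zero, inner_eq_zero_symm.mp h.inner_eq_zero, inner_self_eq_norm_sq_to_K,
      h.norm_left, h.norm_right, Complex.conj_ofReal]
    push_cast
    simp
    ring
  have hn : ∀ a b : ℝ, ‖(a : ℂ) • φ + (b : ℂ) • ψ‖ = 1 → a * a + b * b = 1 := by
    intro a b h1
    have h2 := hin a b a b
    rw [inner_self_eq_norm_sq_to_K, h1] at h2
    have h3 : (1 : ℂ) = ((a * a + b * b : ℝ) : ℂ) := by simpa using h2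
    exact_mod_cast h3.symm
  have h1 := hn a b hab
  have h2 := hn c d hcd
  have h3 : a * c + b * d = 0 := by
    rw [hin] at hi
    exact_mod_cast hi
  have h4 : inner ℂ ((c : ℂ) • φ + (d : ℂ) • ψ) ((a : ℂ) • φ' + (b : ℂ) • ψ') =
      (((b * c - a * d) * ω : ℝ) : ℂ) := by
    simp only [inner_add_left, inner_add_right, inner_smul_left, inner_smul_right,
      h.inner_left_left, h.inner_right_right, h.inner_left_right, h.inner_right_left,
      Complex.conj_ofReal]
    push_cast
    ring
  have h5 : |b * c - a * d| = 1 := by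
    rw [← sq_eq_sq₀ (abs_nonneg _) zero_le_one, sq_abs]
    linear_combination h1 * (c * c + d * d) + h2 - (a * c + b * d) * h3
  rw [h4, Complex.norm_real, Real.norm_eq_abs, abs_mul, h5, one_mul]

end IsCoherentPair

end CoherentPair

section C1Bounds

open Bundle Filter Topology

variable {E : Type*} [NormedAddCommGroup E] [NormedSpace ℝ E] {H : Type*} [TopologicalSpace H]
  {I : ModelWithCorners ℝ E H} {N : Type*} [TopologicalSpace N] [ChartedSpace H N]

theorem c1Norm_nonneg (q : ∀ x : N, TangentSpace I x → ℝ) (f : N → ℝ) : 0 ≤ c1Norm I q f :=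
  le_max_of_le_left (Real.iSup_nonneg fun _ => abs_nonneg _)

theorem continuous_abs_dirDeriv [IsManifold I 1 N] {f : N → ℝ} (hf : ContMDiff I 𝓘(ℝ, ℝ) 1 f) :
    Continuous (fun v : TangentBundle I N => |dirDeriv I f v.1 v.2|) := by
  have h1 := hf.continuous_tangentMap le_rfl
  have h2 : Continuous (fun p : TangentBundle 𝓘(ℝ, ℝ) ℝ => p.2) :=
    (contMDiff_snd_tangentBundle_modelSpace (n := 1) ℝ 𝓘(ℝ, ℝ)).continuous
  exact continuous_abs.comp (h2.comp h1)

theorem bddAbove_dirDeriv_of_isCompact [IsManifold I 1 N] {f : N → ℝ}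
    (hf : ContMDiff I 𝓘(ℝ, ℝ) 1 f) {q : ∀ x : N, TangentSpace I x → ℝ}
    {C : Set (TangentBundle I N)} (hC : IsCompact C)
    (hq : ∀ v : TangentBundle I N, q v.1 v.2 ≤ 1 → v ∈ C) :
    BddAbove (range fun v : {v : TangentBundle I N // q v.1 v.2 ≤ 1} =>
      |dirDeriv I f v.1.1 v.1.2|) := by
  refine (hC.image (continuous_abs_dirDeriv hf)).bddAbove.mono ?_
  rintro _ ⟨v, rfl⟩
  exact ⟨v.1, hq v.1 v.2, rfl⟩

theorem bddAbove_abs [CompactSpace N] {f : N → ℝ} (hf : Continuous f) :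
    BddAbove (range fun x : N => |f x|) :=
  (isCompact_range (continuous_abs.comp hf)).bddAbove

variable [FiniteDimensional ℝ E] [IsManifold I 1 N]

theorem exists_isCompact_unit_vectors [CompactSpace N] [T2Space N]
    (g : ContinuousRiemannianMetric E (fun x : N => TangentSpace I x)) :
    ∃ C : Set (TangentBundle I N), IsCompact C ∧
      ∀ v : TangentBundle I N, metricSq g v.1 v.2 ≤ 1 → v ∈ C := by
  let : RiemannianBundle (fun x : N => TangentSpace I x) := ⟨g.toRiemannianMetric⟩
  have hloc : ∀ x : N, ∃ W ∈ 𝓝 x, ∃ C : Set (TangentBundle I N), IsCompact C ∧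
      ∀ v : TangentBundle I N, v.1 ∈ W → metricSq g v.1 v.2 ≤ 1 → v ∈ C := by
    intro x
    obtain ⟨c, hc, h1⟩ := eventually_norm_trivializationAt_lt E (fun x : N => TangentSpace I x) x
    set e := trivializationAt E (fun x : N => TangentSpace I x) x with he
    have h2 : ∀ᶠ y in 𝓝 x, y ∈ e.baseSet :=
      e.open_baseSet.mem_nhds (FiberBundle.mem_baseSet_trivializationAt' x)
    obtain ⟨W, hW, hWs, hWc⟩ := local_compact_nhds (h1.and h2)
    refine ⟨W, hW, e.toOpenPartialHomeomorph.symm '' (W ×ˢ Metric.closedBall 0 c), ?_, ?_⟩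
    · refine (hWc.prod (isCompact_closedBall 0 c)).image_of_continuousOn
        (e.toOpenPartialHomeomorph.continuousOn_symm.mono ?_)
      rw [e.target_eq]
      exact prod_mono (fun y hy => (hWs hy).2) (subset_univ _)
    · rintro ⟨y, v⟩ hy hv
      have hyb : y ∈ e.baseSet := (hWs hy).2
      have hsrc : (⟨y, v⟩ : TangentBundle I N) ∈ e.source := e.mem_source.mpr hyb
      refine ⟨e ⟨y, v⟩, ⟨?_, ?_⟩, e.toOpenPartialHomeomorph.left_inv hsrc⟩
      · rw [e.coe_fst hsrc]; exact hy
      · have hv1 : ‖v‖ ≤ 1 := by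
          have : ‖v‖ ^ 2 = metricSq g y v := (real_inner_self_eq_norm_sq v).symm
          have h3 : metricSq g y v ≤ 1 := hv
          nlinarith [norm_nonneg v]
        have h4 : (e ⟨y, v⟩).2 = e.continuousLinearMapAt ℝ y v := by
          rw [Trivialization.continuousLinearMapAt_apply, Trivialization.linearMapAt_apply,
            if_pos hyb]
        rw [mem_closedBall_zero_iff, h4]
        refine (ContinuousLinearMap.le_opNorm _ _).trans ?_
        have h5 := (hWs hy).1.le
        nlinarith [norm_nonneg v, norm_nonneg (e.continuousLinearMapAt ℝ y)]
  choose W hW C hC hWC using hloc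
  obtain ⟨t, ht⟩ := isCompact_univ.elim_nhds_subcover W fun x _ => hW x
  refine ⟨⋃ x ∈ t, C x, t.isCompact_biUnion fun x _ => hC x, fun v hv => ?_⟩
  obtain ⟨x, hx, hvx⟩ := mem_iUnion₂.mp (ht.2 (mem_univ v.1))
  exact mem_iUnion₂.mpr ⟨x, hx, hWC x v hvx hv⟩

theorem exists_isCompact_prod_unit_vectors [CompactSpace N] [T2Space N]
    (g : ContinuousRiemannianMetric E (fun x : N => TangentSpace I x)) :
    ∃ C : Set (TangentBundle (I.prod I) (N × N)), IsCompact C ∧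
      ∀ v : TangentBundle (I.prod I) (N × N), prodMetricSq g v.1 v.2 ≤ 1 → v ∈ C := by
  obtain ⟨C, hC, h⟩ := exists_isCompact_unit_vectors g
  have hnn : ∀ (x : N) (v : TangentSpace I x), 0 ≤ metricSq g x v := fun x v => by
    rcases eq_or_ne v 0 with rfl | hv
    · simp [metricSq]
    · exact (g.pos x v hv).le
  refine ⟨(equivTangentBundleProd I N I N).symm '' (C ×ˢ C), (hC.prod hC).image
    (contMDiff_equivTangentBundleProd_symm (n := 0)).continuous, fun v hv => ?_⟩
  refine ⟨equivTangentBundleProd I N I N v, ⟨h _ ?_, h _ ?_⟩, Equiv.symm_apply_apply _ _⟩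
  · refine le_trans ?_ hv
    exact le_add_of_nonneg_right (hnn _ _)
  · refine le_trans ?_ hv
    exact le_add_of_nonneg_left (hnn _ _)

theorem abs_dirDeriv_le [CompactSpace N] [T2Space N]
    (g : ContinuousRiemannianMetric E (fun x : N => TangentSpace I x)) {f : N → ℝ}
    (hf : ContMDiff I 𝓘(ℝ, ℝ) 1 f) (x : N) (v : TangentSpace I x) :
    |dirDeriv I f x v| ≤ Real.sqrt (metricSq g x v) * c1Norm I (metricSq g) f := by
  rcases eq_or_ne v 0 with rfl | hv
  · have h0 : dirDeriv I f x 0 = 0 := map_zero (mfderiv I 𝓘(ℝ, ℝ) f x)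
    rw [h0, abs_zero]
    exact mul_nonneg (Real.sqrt_nonneg _) (c1Norm_nonneg _ _)
  · have hpos : 0 < metricSq g x v := g.pos x v hv
    have hs : 0 < Real.sqrt (metricSq g x v) := Real.sqrt_pos.mpr hpos
    obtain ⟨C, hC, h⟩ := exists_isCompact_unit_vectors g
    have hbdd := bddAbove_dirDeriv_of_isCompact hf hC h
    have hunit : metricSq g x ((Real.sqrt (metricSq g x v))⁻¹ • v) ≤ 1 := by
      have : metricSq g x ((Real.sqrt (metricSq g x v))⁻¹ • v) =
          (Real.sqrt (metricSq g x v))⁻¹ * ((Real.sqrt (metricSq g x v))⁻¹ * metricSq g x v) := by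
        simp [metricSq]
      rw [this, ← mul_assoc, ← mul_inv, Real.mul_self_sqrt hpos.le, inv_mul_cancel₀ hpos.ne']
    have h1 := le_ciSup hbdd ⟨⟨x, (Real.sqrt (metricSq g x v))⁻¹ • v⟩, hunit⟩
    have h2 : dirDeriv I f x ((Real.sqrt (metricSq g x v))⁻¹ • v) =
        (Real.sqrt (metricSq g x v))⁻¹ * dirDeriv I f x v := by
      exact map_smul (mfderiv I 𝓘(ℝ, ℝ) f x) _ v
    have h3 := h1.trans (le_max_right (⨆ x : N, |f x|) _)
    simp only [h2, abs_mul, abs_inv, abs_of_pos hs] at h3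
    rw [inv_mul_le_iff₀ hs] at h3
    exact h3

theorem abs_dirDeriv_vectorField_le [CompactSpace N] [T2Space N]
    (g : ContinuousRiemannianMetric E (fun x : N => TangentSpace I x))
    {v : ∀ x : N, TangentSpace I x}
    (hv : Continuous (fun x : N => (⟨x, v x⟩ : TangentBundle I N))) {f : N → ℝ}
    (hf : ContMDiff I 𝓘(ℝ, ℝ) 1 f) (x : N) :
    |dirDeriv I f x (v x)| ≤ vectorFieldNorm g v * c1Norm I (metricSq g) f := by
  have hne : {c : ℝ | 0 ≤ c ∧ ∀ f : N → ℝ, ContMDiff I 𝓘(ℝ, ℝ) 1 f →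
      ∀ x : N, |dirDeriv I f x (v x)| ≤ c * c1Norm I (metricSq g) f}.Nonempty := by
    let : RiemannianBundle (fun x : N => TangentSpace I x) := ⟨g.toRiemannianMetric⟩
    have hc : Continuous (fun x : N => metricSq g x (v x)) := hv.inner_bundle hv
    obtain ⟨c, hc⟩ := (isCompact_range (Real.continuous_sqrt.comp hc)).bddAbove
    refine ⟨max c 0, le_max_right _ _, fun f hf x => (abs_dirDeriv_le g hf x (v x)).trans ?_⟩
    exact mul_le_mul_of_nonneg_right ((hc ⟨x, rfl⟩).trans (le_max_left _ _)) (c1Norm_nonneg _ _)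
  rcases (c1Norm_nonneg (metricSq g) f).eq_or_lt with h0 | h0
  · obtain ⟨c, -, hc⟩ := hne
    have := hc f hf x
    rwa [← h0, mul_zero] at this ⊢
  · rw [← div_le_iff₀ h0]
    refine le_csInf hne fun c hc => ?_
    rw [div_le_iff₀ h0]
    exact hc.2 f hf x

omit [FiniteDimensional ℝ E] in
theorem vectorFieldNorm_nonneg
    (g : ContinuousRiemannianMetric E (fun x : N => TangentSpace I x))
    (v : ∀ x : N, TangentSpace I x) : 0 ≤ vectorFieldNorm g v :=
  Real.sInf_nonneg fun _ hc => hc.1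

omit [FiniteDimensional ℝ E] [IsManifold I 1 N] in
theorem contMDiff_slice {f : N × N → ℝ} (hf : ContMDiff (I.prod I) 𝓘(ℝ, ℝ) 1 f) (y : N) :
    ContMDiff I 𝓘(ℝ, ℝ) 1 (fun x => f (x, y)) :=
  hf.comp (contMDiff_id.prodMk contMDiff_const)

theorem c1Norm_slice_le [CompactSpace N] [T2Space N]
    (g : ContinuousRiemannianMetric E (fun x : N => TangentSpace I x)) {f : N × N → ℝ}
    (hf : ContMDiff (I.prod I) 𝓘(ℝ, ℝ) 1 f) (y : N) :
    c1Norm I (metricSq g) (fun x => f (x, y)) ≤ c1Norm (I.prod I) (prodMetricSq g) f := by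
  obtain ⟨C, hC, h⟩ := exists_isCompact_prod_unit_vectors g
  have hbdd := bddAbove_dirDeriv_of_isCompact hf hC h
  refine max_le_max ?_ ?_
  · refine Real.iSup_le (fun x => ?_) (Real.iSup_nonneg fun _ => abs_nonneg _)
    exact le_ciSup (bddAbove_abs hf.continuous) (x, y)
  · refine Real.iSup_le (fun v => ?_) (Real.iSup_nonneg fun _ => abs_nonneg _)
    obtain ⟨⟨x, v⟩, hv⟩ := v
    have hv' : prodMetricSq g (x, y) ((v, 0) : E × E) ≤ 1 := by
      refine le_trans (le_of_eq ?_) hv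
      have : metricSq g y (0 : TangentSpace I y) = 0 := by simp [metricSq]
      exact (congrArg (metricSq g x v + ·) this).trans (add_zero _)
    have h1 := le_ciSup hbdd ⟨⟨(x, y), ((v, 0) : E × E)⟩, hv'⟩
    refine le_of_eq_of_le ?_ h1
    have h2 : mfderiv I 𝓘(ℝ, ℝ) (fun x => f (x, y)) x =
        (mfderiv (I.prod I) 𝓘(ℝ, ℝ) f (x, y)).comp
          (mfderiv I (I.prod I) (fun x => (x, y)) x) :=
      mfderiv_comp x (hf.mdifferentiableAt one_ne_zero)
        (mdifferentiableAt_id.prodMk mdifferentiableAt_const)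
    simp only [dirDeriv, h2, mfderiv_prod_left]
    rfl

end C1Bounds

section FlowDerivative

variable {Ω : Type*} [MetricSpace Ω] {Φ : Flow ℝ Ω}
  {E : Type*} [NormedAddCommGroup E] [NormedSpace ℝ E] {H : Type*} [TopologicalSpace H]
  {I : ModelWithCorners ℝ E H} {M : Set Ω} [ChartedSpace H M]

/-- A function on the manifold is differentiable along a complete orbit in the manifold. -/
theorem hasDerivAt_comp_flow {hM : ∀ t : ℝ, 0 ≤ t → MapsTo (Φ t) M M}
    {v : ∀ x : M, TangentSpace I x}
    (hvΦ : ∀ x : M, IsMIntegralCurveOn (fun t : ℝ => restrictFlow Φ M hM t x) v (Ici 0))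
    {f : Ω → ℝ} (hf : MDifferentiable I 𝓘(ℝ, ℝ) (fun x : M => f x)) {x : Ω}
    (hx : ∀ s : ℝ, Φ s x ∈ M) (s : ℝ) :
    HasDerivAt (fun s => f (Φ s x))
      (dirDeriv I (fun x : M => f x) ⟨Φ s x, hx s⟩ (v ⟨Φ s x, hx s⟩)) s := by
  set c : ℝ → M := fun t => restrictFlow Φ M hM t ⟨Φ (s - 1) x, hx _⟩ with hc
  have hcv : ∀ t, 0 ≤ t → (c t : Ω) = Φ (t + (s - 1)) x := fun t ht => by
    simp [hc, restrictFlow, max_eq_left ht, Φ.map_add]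
  have hc1 : c 1 = ⟨Φ s x, hx s⟩ := Subtype.ext (by rw [hcv 1 zero_le_one]; simp)
  have h1 : HasMFDerivAt 𝓘(ℝ, ℝ) I c 1 ((1 : ℝ →L[ℝ] ℝ).smulRight (v (c 1))) :=
    (hvΦ ⟨Φ (s - 1) x, hx _⟩ 1 (mem_Ici.mpr zero_le_one)).hasMFDerivAt (Ici_mem_nhds zero_lt_one)
  let L : ℝ →L[ℝ] ℝ := (mfderiv I 𝓘(ℝ, ℝ) (fun x : M => f x) (c 1)).comp
    ((1 : ℝ →L[ℝ] ℝ).smulRight (v (c 1)))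
  have h2 : HasFDerivAt (fun t => f (c t)) L (1 : ℝ) :=
    ((hf (c 1)).hasMFDerivAt.comp 1 h1).hasFDerivAt
  have h3 := h2.hasDerivAt
  have h4 : HasDerivAt (fun t => f (Φ (t + (s - 1)) x))
      (dirDeriv I (fun x : M => f x) ⟨Φ s x, hx s⟩ (v ⟨Φ s x, hx s⟩)) 1 := by
    rw [← hc1]
    refine (h3.congr_of_eventuallyEq ?_).congr_deriv ?_
    · filter_upwards [Ici_mem_nhds (zero_lt_one (α := ℝ))] with t ht
      rw [hcv t ht]
    · exact congrArg (mfderiv I 𝓘(ℝ, ℝ) (fun x : M => f x) (c 1)) (one_smul ℝ (v (c 1)))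
  have h5 := HasDerivAt.comp_sub_const s (s - 1) (f := fun t => f (Φ (t + (s - 1)) x))
    (by simpa using h4)
  simpa using h5

/-- The squared distance between a moving point and a fixed point of the manifold has a bounded
derivative along the flow. -/
theorem exists_hasDerivAt_sqDist_flow [FiniteDimensional ℝ E] [IsManifold I 1 M]
    (hMc : IsCompact M) {hM : ∀ t : ℝ, 0 ≤ t → MapsTo (Φ t) M M}
    {v : ∀ x : M, TangentSpace I x}
    (hv : Continuous (fun x : M => (⟨x, v x⟩ : TangentBundle I M)))
    (hvΦ : ∀ x : M, IsMIntegralCurveOn (fun t : ℝ => restrictFlow Φ M hM t x) v (Ici 0))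
    (g : Bundle.ContinuousRiemannianMetric E (fun x : M => TangentSpace I x))
    {Y : Type*} [NormedAddCommGroup Y] {F : Ω → Y}
    (hd : ContMDiff (I.prod I) 𝓘(ℝ, ℝ) 1 (fun p : M × M => sqDist F p.1 p.2)) {x y : Ω}
    (hx : ∀ s : ℝ, Φ s x ∈ M) (hy : y ∈ M) (s : ℝ) :
    ∃ D, HasDerivAt (fun s => sqDist F (Φ s x) y) D s ∧ |D| ≤ vectorFieldNorm g v *
      c1Norm (I.prod I) (prodMetricSq g) (fun p : M × M => sqDist F p.1 p.2) := by
  have : CompactSpace M := isCompact_iff_compactSpace.mp hMc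
  have hf := contMDiff_slice hd ⟨y, hy⟩
  refine ⟨_, hasDerivAt_comp_flow hvΦ (f := fun x => sqDist F x y)
    (hf.mdifferentiable one_ne_zero) hx s, ?_⟩
  exact (abs_dirDeriv_vectorField_le g hv hf _).trans
    (mul_le_mul_of_nonneg_left (c1Norm_slice_le g hd ⟨y, hy⟩) (vectorFieldNorm_nonneg g v))

end FlowDerivative

section KernelOperator

open Filter Topology

variable {Ω : Type*} [MetricSpace Ω] [MeasurableSpace Ω] [BorelSpace Ω]
  {μ : Measure Ω} [IsProbabilityMeasure μ] {k : Ω → Ω → ℝ}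

theorem kernelOp_apply_ae (hk : IsBoundedKernel k) (f : Lp ℂ 2 μ) :
    kernelOp μ k hk f =ᵐ[μ] kernelIntegral μ k f :=
  (memLp_kernelIntegral hk f).coeFn_toLp

omit [MetricSpace Ω] [BorelSpace Ω] in
theorem norm_Lp_two_le_of_ae_bound {f : Lp ℂ 2 μ} {C : ℝ} (hC : 0 ≤ C) (h : ∀ᵐ x ∂μ, ‖f x‖ ≤ C) :
    ‖f‖ ≤ C := by
  simpa [measureUnivNNReal] using Lp.norm_le_of_ae_bound hC h

theorem norm_integral_mul_le {a : Ω → ℂ} {ε : ℝ} (hε : 0 ≤ ε) (ha : ∀ᵐ y ∂μ, ‖a y‖ ≤ ε)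
    (f : Lp ℂ 2 μ) : ‖∫ y, a y * f y ∂μ‖ ≤ ε * ‖f‖ := by
  refine (norm_integral_le_of_norm_le ((integrable_of_Lp_two f).norm.const_mul ε) ?_).trans ?_
  · filter_upwards [ha] with y hy
    rw [norm_mul]
    exact mul_le_mul_of_nonneg_right hy (norm_nonneg _)
  · rw [integral_const_mul]
    exact mul_le_mul_of_nonneg_left (integral_norm_le_norm_Lp_two f) hε

/-- The indicator of a fibre of a simple function. -/
def fiberIndicator (μ : Measure Ω) [IsProbabilityMeasure μ] (π : SimpleFunc Ω Ω) (a : Ω) :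
    Lp ℂ 2 μ :=
  indicatorConstLp 2 (π.measurableSet_fiber a) (measure_ne_top μ _) (1 : ℂ)

/-- The integral operator with the kernel `k (π x) (π y)`, where `π` is a simple function. -/
def stepOp (μ : Measure Ω) [IsProbabilityMeasure μ] (k : Ω → Ω → ℝ) (π : SimpleFunc Ω Ω) :
    Lp ℂ 2 μ →L[ℂ] Lp ℂ 2 μ :=
  ∑ a ∈ π.range, ∑ b ∈ π.range,
    (k a b : ℂ) • (innerSL ℂ (fiberIndicator μ π b)).smulRight (fiberIndicator μ π a)

omit [MetricSpace Ω] [BorelSpace Ω] in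
theorem stepOp_apply (π : SimpleFunc Ω Ω) (f : Lp ℂ 2 μ) :
    stepOp μ k π f = ∑ a ∈ π.range, ∑ b ∈ π.range,
      ((k a b : ℂ) * inner ℂ (fiberIndicator μ π b) f) • fiberIndicator μ π a := by
  simp only [stepOp, sum_apply, smul_apply, ContinuousLinearMap.smulRight_apply,
    innerSL_apply_apply, mul_smul]

omit [MetricSpace Ω] [BorelSpace Ω] in
theorem isCompactOperator_stepOp (π : SimpleFunc Ω Ω) : IsCompactOperator (stepOp μ k π) := by
  have h : stepOp μ k π ∈ compactOperator (RingHom.id ℂ) (Lp ℂ 2 μ) (Lp ℂ 2 μ) := by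
    refine Submodule.sum_mem _ fun a _ => Submodule.sum_mem _ fun b _ => Submodule.smul_mem _ _ ?_
    have h1 : IsCompactOperator (ContinuousLinearMap.toSpanSingleton ℂ (fiberIndicator μ π a)) :=
      isCompactOperator_of_locallyCompactSpace_rng
        (ContinuousLinearMap.toSpanSingleton ℂ (fiberIndicator μ π a))
    exact h1.comp_clm (innerSL ℂ (fiberIndicator μ π b))
  exact h

omit [MetricSpace Ω] [BorelSpace Ω] in
theorem isSymmetric_stepOp (hs : ∀ x y, k x y = k y x) (π : SimpleFunc Ω Ω) :
    (stepOp μ k π : Lp ℂ 2 μ →ₗ[ℂ] Lp ℂ 2 μ).IsSymmetric := by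
  intro f g
  rw [ContinuousLinearMap.coe_coe, stepOp_apply, stepOp_apply]
  simp only [sum_inner, inner_sum, inner_smul_left, inner_smul_right, map_mul, Complex.conj_ofReal,
    inner_conj_symm]
  rw [Finset.sum_comm]
  refine Finset.sum_congr rfl fun a _ => Finset.sum_congr rfl fun b _ => ?_
  rw [hs b a]
  ring

open scoped Classical in
theorem stepOp_apply_ae (π : SimpleFunc Ω Ω) (f : Lp ℂ 2 μ) :
    stepOp μ k π f =ᵐ[μ] fun x => ∫ y, (k (π x) (π y) : ℂ) * f y ∂μ := by
  have hI : ∀ a ∈ π.range, ∀ᵐ x ∂μ, fiberIndicator μ π a x = if π x = a then 1 else 0 := by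
    intro a _
    filter_upwards [indicatorConstLp_coeFn (p := 2) (hs := π.measurableSet_fiber a)
      (hμs := measure_ne_top μ _) (c := (1 : ℂ))] with x hx
    rw [fiberIndicator, hx]
    simp [indicator_apply]
  have h1 : stepOp μ k π f = ∑ a ∈ π.range, (∑ b ∈ π.range,
      ((k a b : ℂ) * inner ℂ (fiberIndicator μ π b) f)) • fiberIndicator μ π a := by
    rw [stepOp_apply]
    simp only [Finset.sum_smul]
  rw [h1]
  have h2 := (Finset.eventually_all π.range).mpr hI
  have h3 := (Finset.eventually_all π.range).mpr fun a _ => Lp.coeFn_smul (∑ b ∈ π.range,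
      ((k a b : ℂ) * inner ℂ (fiberIndicator μ π b) f)) (fiberIndicator μ π a)
  have h4 := Lp.coeFn_finsetSum π.range fun a => (∑ b ∈ π.range,
      ((k a b : ℂ) * inner ℂ (fiberIndicator μ π b) f)) • fiberIndicator μ π a
  filter_upwards [h2, h3, h4] with x h2 h3 h4
  rw [h4, Finset.sum_apply, Finset.sum_congr rfl fun a ha => (h3 a ha).trans
    (by rw [Pi.smul_apply, h2 a ha, smul_eq_mul, mul_ite, mul_one, mul_zero])]
  rw [Finset.sum_ite_eq, if_pos (π.mem_range_self x)]
  have hu : (⋃ b ∈ π.range, π ⁻¹' {b}) = univ := by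
    refine eq_univ_of_forall fun y => mem_iUnion₂.mpr ⟨π y, π.mem_range_self y, rfl⟩
  have hint : ∀ b ∈ π.range, IntegrableOn (fun y => (k (π x) (π y) : ℂ) * f y) (π ⁻¹' {b}) μ :=
    fun b _ => by
      refine ((integrable_of_Lp_two f).integrableOn.const_mul (k (π x) b : ℂ)).congr ?_
      filter_upwards [ae_restrict_mem (π.measurableSet_fiber b)] with y hy
      rw [show π y = b from hy]
  rw [← setIntegral_univ, ← hu, integral_biUnion_finset _
    (fun b _ => π.measurableSet_fiber b) ?_ hint]
  · refine Finset.sum_congr rfl fun b _ => ?_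
    rw [fiberIndicator, L2.inner_indicatorConstLp_one, ← integral_const_mul]
    refine setIntegral_congr_fun (π.measurableSet_fiber b) fun y hy => ?_
    rw [show π y = b from hy]
  · intro a _ b _ hab
    exact Disjoint.preimage π (disjoint_singleton.mpr hab)

theorem exists_stepOp_near (hX : IsCompact μ.support) (hμX : μ μ.supportᶜ = 0)
    (hk : IsBoundedKernel k) {ε : ℝ} (hε : 0 < ε) :
    ∃ π : SimpleFunc Ω Ω, ‖kernelOp μ k hk - stepOp μ k π‖ ≤ ε := by
  have hae : ∀ᵐ x ∂μ, x ∈ μ.support := mem_ae_iff.mpr hμX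
  have hne : μ.support.Nonempty := by
    obtain ⟨x, hx⟩ := hae.exists
    exact ⟨x, hx⟩
  have huc := (hX.prod hX).uniformContinuousOn_of_continuous hk.continuous.continuousOn
  obtain ⟨δ, hδ, hd⟩ := Metric.uniformContinuousOn_iff.mp huc ε hε
  obtain ⟨t, htX, htf, hcov⟩ := hX.finite_cover_balls hδ
  have htne : t.Nonempty := by
    by_contra h
    rw [not_nonempty_iff_eq_empty] at h
    subst h
    simpa using hcov hne.some_mem
  obtain ⟨e, rfl⟩ := htf.countable.exists_eq_range htne
  obtain ⟨s, hs⟩ := hX.elim_finite_subcover (fun n => Metric.ball (e n) δ)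
    (fun _ => Metric.isOpen_ball) (by simpa using hcov)
  let π := SimpleFunc.nearestPt e (s.sup id)
  have hπX : ∀ x, π x ∈ μ.support := fun x =>
    htX ⟨_, rfl⟩
  have hπd : ∀ x ∈ μ.support, dist x (π x) < δ := by
    intro x hx
    obtain ⟨n, hn, hxn⟩ := mem_iUnion₂.mp (hs hx)
    have h1 := SimpleFunc.edist_nearestPt_le e x (Finset.le_sup (f := id) hn)
    rw [edist_dist, edist_dist, ENNReal.ofReal_le_ofReal_iff dist_nonneg] at h1
    rw [dist_comm]
    refine h1.trans_lt ?_
    rw [dist_comm]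
    exact hxn
  refine ⟨π, ContinuousLinearMap.opNorm_le_bound _ hε.le fun f => ?_⟩
  refine norm_Lp_two_le_of_ae_bound (by positivity) ?_
  filter_upwards [hae, kernelOp_apply_ae hk f, stepOp_apply_ae (k := k) π f,
    Lp.coeFn_sub (kernelOp μ k hk f) (stepOp μ k π f)] with x hx h1 h2 h3
  have hint : Integrable (fun y => (k (π x) (π y) : ℂ) * f y) μ := by
    obtain ⟨C, hC⟩ := hk.bounded
    refine ((integrable_of_Lp_two f).norm.const_mul C).mono' ?_
      (Eventually.of_forall fun y => norm_kernel_mul_le (fun x y => hC x (π y)) f (π x) y)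
    have hm : StronglyMeasurable (fun y => (k (π x) (π y) : ℂ)) :=
      (π.map fun b => (k (π x) b : ℂ)).stronglyMeasurable
    exact hm.aestronglyMeasurable.mul (Lp.aestronglyMeasurable f)
  have h4 : (kernelOp μ k hk f) x - (stepOp μ k π f) x =
      ∫ y, ((k x y - k (π x) (π y) : ℝ) : ℂ) * f y ∂μ := by
    rw [h1, h2, kernelIntegral, ← integral_sub
      (integrable_kernel_mul hk (integrable_of_Lp_two f) x) hint]
    refine integral_congr_ae (Eventually.of_forall fun y => ?_)
    push_cast
    ring
  rw [sub_apply, h3, Pi.sub_apply, h4]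
  refine norm_integral_mul_le hε.le ?_ f
  filter_upwards [hae] with y hy
  rw [Complex.norm_real, ← dist_eq_norm]
  refine (hd (x, y) ⟨hx, hy⟩ (π x, π y) ⟨hπX x, hπX y⟩ ?_).le
  rw [Prod.dist_eq]
  exact max_lt (hπd x hx) (hπd y hy)

theorem exists_tendsto_stepOp (hX : IsCompact μ.support) (hμX : μ μ.supportᶜ = 0)
    (hk : IsBoundedKernel k) :
    ∃ π : ℕ → SimpleFunc Ω Ω, Tendsto (fun n => stepOp μ k (π n)) atTop (𝓝 (kernelOp μ k hk)) := by
  choose π hπ using fun n : ℕ => exists_stepOp_near hX hμX hk (ε := 1 / ((n : ℝ) + 1))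
    (by positivity)
  refine ⟨π, tendsto_iff_norm_sub_tendsto_zero.mpr ?_⟩
  refine squeeze_zero (fun _ => norm_nonneg _) (fun n => ?_)
    tendsto_one_div_add_atTop_nhds_zero_nat
  rw [norm_sub_rev]
  exact hπ n

theorem isCompactOperator_kernelOp (hX : IsCompact μ.support) (hμX : μ μ.supportᶜ = 0)
    (hk : IsBoundedKernel k) : IsCompactOperator (kernelOp μ k hk) := by
  obtain ⟨π, hπ⟩ := exists_tendsto_stepOp hX hμX hk
  exact isCompactOperator_of_tendsto hπ (Eventually.of_forall fun n => isCompactOperator_stepOp _)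

theorem isSymmetric_kernelOp (hX : IsCompact μ.support) (hμX : μ μ.supportᶜ = 0)
    (hk : IsBoundedKernel k) (hs : ∀ x y, k x y = k y x) :
    (kernelOp μ k hk : Lp ℂ 2 μ →ₗ[ℂ] Lp ℂ 2 μ).IsSymmetric := by
  obtain ⟨π, hπ⟩ := exists_tendsto_stepOp hX hμX hk
  intro f g
  have h1 : ∀ f, Tendsto (fun n => stepOp μ k (π n) f) atTop (𝓝 (kernelOp μ k hk f)) := fun f =>
    ((ContinuousLinearMap.apply ℂ (Lp ℂ 2 μ) f).continuous.tendsto _).comp hπ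
  have h2 := (h1 f).inner (𝕜 := ℂ) (tendsto_const_nhds (x := g))
  have h3 := (tendsto_const_nhds (x := f)).inner (𝕜 := ℂ) (h1 g)
  refine tendsto_nhds_unique h2 (h3.congr fun n => ?_)
  exact (isSymmetric_stepOp hs (π n) f g).symm

end KernelOperator

section LTwo

open Filter Topology

variable {Ω : Type*} [MeasurableSpace Ω] {μ : Measure Ω}

theorem norm_sq_eq_integral (f : Lp ℂ 2 μ) : ‖f‖ ^ 2 = ∫ x, ‖f x‖ ^ 2 ∂μ := by
  have h1 : inner ℂ f f = ∫ x, ((‖f x‖ ^ 2 : ℝ) : ℂ) ∂μ := by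
    rw [L2.inner_def]
    refine integral_congr_ae (Eventually.of_forall fun x => ?_)
    simp only [inner_self_eq_norm_sq_to_K]
    norm_cast
  rw [integral_complex_ofReal, inner_self_eq_norm_sq_to_K] at h1
  exact Complex.ofReal_injective (by simpa using h1)

theorem im_inner_eq_zero {f g : Lp ℂ 2 μ} (hf : ∀ᵐ x ∂μ, (f x).im = 0)
    (hg : ∀ᵐ x ∂μ, (g x).im = 0) : (inner ℂ f g : ℂ).im = 0 := by
  have h1 : inner ℂ f g = ∫ x, (((f x).re * (g x).re : ℝ) : ℂ) ∂μ := by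
    rw [L2.inner_def]
    refine integral_congr_ae ?_
    filter_upwards [hf, hg] with x hx hy
    apply Complex.ext <;> simp [hx, hy, mul_comm]
  rw [h1, integral_complex_ofReal]
  exact Complex.ofReal_im _

theorem tendsto_Lp_two_of_bounded [IsProbabilityMeasure μ] {ι : Type*} {l : Filter ι}
    [l.IsCountablyGenerated] {f : ι → Lp ℂ 2 μ} {g : Lp ℂ 2 μ} {u : ι → Ω → ℂ} {C : ℝ}
    (hfu : ∀ i, f i =ᵐ[μ] u i) (hu : ∀ᶠ i in l, ∀ᵐ x ∂μ, ‖u i x‖ ≤ C) (hg : ∀ᵐ x ∂μ, ‖g x‖ ≤ C)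
    (hlim : ∀ᵐ x ∂μ, Tendsto (fun i => u i x) l (𝓝 (g x))) : Tendsto f l (𝓝 g) := by
  have hsub : ∀ i, ‖f i - g‖ ^ 2 = ∫ x, ‖u i x - g x‖ ^ 2 ∂μ := fun i => by
    rw [norm_sq_eq_integral]
    refine integral_congr_ae ?_
    filter_upwards [Lp.coeFn_sub (f i) g, hfu i] with x h1 h2
    rw [h1, Pi.sub_apply, h2]
  have h1 : Tendsto (fun i => ∫ x, ‖u i x - g x‖ ^ 2 ∂μ) l (𝓝 (∫ _, (0 : ℝ) ∂μ)) := by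
    refine tendsto_integral_filter_of_dominated_convergence (fun _ => (2 * C) ^ 2) ?_ ?_
      (integrable_const _) ?_
    · refine Eventually.of_forall fun i => ?_
      exact ((((Lp.aestronglyMeasurable (f i)).congr (hfu i)).sub
        (Lp.aestronglyMeasurable g)).norm.pow 2)
    · filter_upwards [hu] with i hi
      filter_upwards [hi, hg] with x h1 h2
      rw [Real.norm_of_nonneg (by positivity)]
      refine pow_le_pow_left₀ (norm_nonneg _) ((norm_sub_le _ _).trans ?_) 2
      linarith
    · filter_upwards [hlim] with x hx
      have := ((hx.sub_const (g x)).norm).pow 2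
      simpa using this
  rw [tendsto_iff_norm_sub_tendsto_zero]
  simp only [← hsub, integral_zero] at h1
  have h2 := h1.sqrt
  simpa [Real.sqrt_sq (norm_nonneg _)] using h2

end LTwo

section Koopman

open Filter Topology

variable {Ω : Type*} [MetricSpace Ω] [MeasurableSpace Ω] {Φ : Flow ℝ Ω} {μ : Measure Ω}

theorem koopman_apply_ae (hμ : IsErgodicFlow Φ μ) (t : ℝ) (f : Lp ℂ 2 μ) :
    koopman Φ μ hμ t f =ᵐ[μ] fun x => f (Φ t x) :=
  Lp.coeFn_compMeasurePreserving f (hμ.measurePreserving t)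

theorem ae_comp_flow (hμ : IsErgodicFlow Φ μ) (t : ℝ) {p : Ω → Prop} (hp : ∀ᵐ x ∂μ, p x) :
    ∀ᵐ x ∂μ, p (Φ t x) :=
  (hμ.measurePreserving t).quasiMeasurePreserving.ae hp

theorem koopman_zero (hμ : IsErgodicFlow Φ μ) (f : Lp ℂ 2 μ) : koopman Φ μ hμ 0 f = f := by
  refine Lp.ext ((koopman_apply_ae hμ 0 f).trans (Eventually.of_forall fun x => ?_))
  simp

theorem koopman_add (hμ : IsErgodicFlow Φ μ) (s t : ℝ) (f : Lp ℂ 2 μ) :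
    koopman Φ μ hμ (s + t) f = koopman Φ μ hμ s (koopman Φ μ hμ t f) := by
  refine Lp.ext ?_
  filter_upwards [koopman_apply_ae hμ (s + t) f, koopman_apply_ae hμ s (koopman Φ μ hμ t f),
    ae_comp_flow hμ s (koopman_apply_ae hμ t f)] with x h1 h2 h3
  rw [h1, h2, h3, ← Φ.map_add, add_comm]

theorem koopman_real (hμ : IsErgodicFlow Φ μ) (t : ℝ) {f : Lp ℂ 2 μ} (hf : ∀ᵐ x ∂μ, (f x).im = 0) :
    ∀ᵐ x ∂μ, (koopman Φ μ hμ t f x).im = 0 := by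
  filter_upwards [koopman_apply_ae hμ t f, ae_comp_flow hμ t hf] with x h1 h2
  rw [h1, h2]

/-- The matrix elements of the generator between real functions are real. -/
theorem im_inner_generator_eq_zero (hμ : IsErgodicFlow Φ μ) {f g g' : Lp ℂ 2 μ}
    (hf : ∀ᵐ x ∂μ, (f x).im = 0) (hg : ∀ᵐ x ∂μ, (g x).im = 0)
    (hd : HasDerivAt (fun t => koopman Φ μ hμ t g) g' 0) : (inner ℂ f g' : ℂ).im = 0 := by
  have h1 : HasDerivAt (fun t => (inner ℂ f (koopman Φ μ hμ t g) : ℂ)) (inner ℂ f g') 0 := by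
    simpa using (hasDerivAt_const (0 : ℝ) f).inner ℂ hd
  have h2 := Complex.imCLM.hasFDerivAt.comp_hasDerivAt (0 : ℝ) h1
  have h3 : HasDerivAt (fun _ : ℝ => (0 : ℝ)) (Complex.imCLM (inner ℂ f g')) 0 := by
    refine h2.congr_of_eventuallyEq (Eventually.of_forall fun t => ?_)
    exact (im_inner_eq_zero hf (koopman_real hμ t hg)).symm
  exact (h3.unique (hasDerivAt_const 0 0))

theorem flow_mem_support (hμ : IsErgodicFlow Φ μ) {x : Ω} (hx : x ∈ μ.support) (t : ℝ) :
    Φ t x ∈ μ.support := by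
  rw [Measure.support_eq_forall_isOpen] at hx ⊢
  intro u hu hou
  have h1 := hx (Φ t ⁻¹' u) hu (hou.preimage (Φ.continuous continuous_const continuous_id))
  exact h1.trans_le ((hμ.measurePreserving t).measure_preimage_le u)

/-- Differentiability of the orbit of a function under the Koopman group, from the differentiability
along the orbits of the flow and a Lipschitz bound. -/
theorem exists_hasDerivAt_koopman [IsProbabilityMeasure μ] (hμ : IsErgodicFlow Φ μ)
    {f : Lp ℂ 2 μ} {u : Ω → ℂ} (hfu : f =ᵐ[μ] u) {C : ℝ} (hC : 0 ≤ C)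
    (hL : ∀ᵐ x ∂μ, ∀ s, ‖u (Φ s x) - u x‖ ≤ C * |s|)
    (hd : ∀ᵐ x ∂μ, DifferentiableAt ℝ (fun s => u (Φ s x)) 0) :
    ∃ f', HasDerivAt (fun t => koopman Φ μ hμ t f) f' 0 ∧ ‖f'‖ ≤ C := by
  set G : Ω → ℂ := fun x => deriv (fun s => u (Φ s x)) 0 with hG
  set q : ℝ → Ω → ℂ := fun s x => s⁻¹ • (u (Φ s x) - u x) with hq
  have hku : ∀ s, (s⁻¹ • (koopman Φ μ hμ s f - f) : Lp ℂ 2 μ) =ᵐ[μ] q s := fun s => by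
    filter_upwards [Lp.coeFn_smul s⁻¹ (koopman Φ μ hμ s f - f), Lp.coeFn_sub (koopman Φ μ hμ s f) f,
      koopman_apply_ae hμ s f, ae_comp_flow hμ s hfu, hfu] with x h1 h2 h3 h4 h5
    rw [h1, Pi.smul_apply, h2, Pi.sub_apply, h3, h4, h5]
  have hqC : ∀ᵐ x ∂μ, ∀ s, ‖q s x‖ ≤ C := by
    filter_upwards [hL] with x hx s
    rw [hq, norm_smul, norm_inv, Real.norm_eq_abs]
    rcases eq_or_ne s 0 with rfl | hs
    · simpa using hC
    · rw [inv_mul_le_iff₀ (abs_pos.mpr hs), mul_comm]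
      exact hx s
  have hqG : ∀ᵐ x ∂μ, Tendsto (fun s => q s x) (𝓝[≠] 0) (𝓝 (G x)) := by
    filter_upwards [hd] with x hx
    have := hasDerivAt_iff_tendsto_slope_zero.mp hx.hasDerivAt
    simpa [hq] using this
  have hGm : AEStronglyMeasurable G μ := by
    have hseq : Tendsto (fun n : ℕ => 1 / ((n : ℝ) + 1)) atTop (𝓝[≠] 0) :=
      tendsto_nhdsWithin_iff.mpr ⟨tendsto_one_div_add_atTop_nhds_zero_nat,
        Eventually.of_forall fun n => (Nat.one_div_pos_of_nat).ne'⟩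
    refine aestronglyMeasurable_of_tendsto_ae atTop (f := fun n : ℕ => q (1 / ((n : ℝ) + 1)))
      (fun n => (Lp.aestronglyMeasurable _).congr (hku _)) ?_
    filter_upwards [hqG] with x hx
    exact hx.comp hseq
  have hGC : ∀ᵐ x ∂μ, ‖G x‖ ≤ C := by
    filter_upwards [hqG, hqC] with x h1 h2
    exact le_of_tendsto' h1.norm h2
  have hGp : MemLp G 2 μ := MemLp.of_bound hGm C hGC
  have hcoe : ∀ᵐ x ∂μ, ‖hGp.toLp G x‖ ≤ C := by
    filter_upwards [hGp.coeFn_toLp, hGC] with x h1 h2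
    rwa [h1]
  refine ⟨hGp.toLp G, ?_, norm_Lp_two_le_of_ae_bound hC hcoe⟩
  rw [hasDerivAt_iff_tendsto_slope_zero]
  simp only [zero_add, koopman_zero]
  refine tendsto_Lp_two_of_bounded hku (Eventually.of_forall fun s => hqC.mono fun x hx => hx s)
    hcoe ?_
  filter_upwards [hqG, hGp.coeFn_toLp] with x h1 h2
  rwa [h2]

/-- A bound for the commutator of a Koopman operator and an integral operator. -/
theorem norm_koopman_kernelOp_sub_le [BorelSpace Ω] [IsProbabilityMeasure μ]
    (hμ : IsErgodicFlow Φ μ) (hμX : μ μ.supportᶜ = 0) {k : Ω → Ω → ℝ} (hk : IsBoundedKernel k)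
    {ε t : ℝ} (hε : 0 ≤ ε)
    (h : ∀ x ∈ μ.support, ∀ y ∈ μ.support, |k (Φ t x) (Φ t y) - k x y| ≤ ε) (f : Lp ℂ 2 μ) :
    ‖koopman Φ μ hμ t (kernelOp μ k hk f) - kernelOp μ k hk (koopman Φ μ hμ t f)‖ ≤ ε * ‖f‖ := by
  have hae : ∀ᵐ x ∂μ, x ∈ μ.support := mem_ae_iff.mpr hμX
  refine norm_Lp_two_le_of_ae_bound (by positivity) ?_
  filter_upwards [hae, Lp.coeFn_sub (koopman Φ μ hμ t (kernelOp μ k hk f))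
    (kernelOp μ k hk (koopman Φ μ hμ t f)), koopman_apply_ae hμ t (kernelOp μ k hk f),
    ae_comp_flow hμ t (kernelOp_apply_ae hk f),
    kernelOp_apply_ae hk (koopman Φ μ hμ t f)] with x hx h1 h2 h3 h4
  have hemb : MeasurableEmbedding (Φ t) := (Φ.toHomeomorph t).measurableEmbedding
  have h5 : kernelIntegral μ k f (Φ t x) =
      ∫ y, (k (Φ t x) (Φ t y) : ℂ) * koopman Φ μ hμ t f y ∂μ := by
    rw [kernelIntegral, ← (hμ.measurePreserving t).integral_comp hemb]
    refine integral_congr_ae ?_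
    filter_upwards [koopman_apply_ae hμ t f] with y hy
    rw [hy]
  have hint : Integrable (fun y => (k (Φ t x) (Φ t y) : ℂ) * koopman Φ μ hμ t f y) μ := by
    have h6 := (hμ.measurePreserving t).integrable_comp_of_integrable
      (integrable_kernel_mul hk (integrable_of_Lp_two f) (Φ t x))
    refine h6.congr ?_
    filter_upwards [koopman_apply_ae hμ t f] with y hy
    simp [hy]
  have h6 : (koopman Φ μ hμ t (kernelOp μ k hk f)) x - (kernelOp μ k hk (koopman Φ μ hμ t f)) x =
      ∫ y, ((k (Φ t x) (Φ t y) - k x y : ℝ) : ℂ) * koopman Φ μ hμ t f y ∂μ := by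
    rw [h2, h3, h4, h5, kernelIntegral, ← integral_sub hint
      (integrable_kernel_mul hk (integrable_of_Lp_two _) x)]
    refine integral_congr_ae (Eventually.of_forall fun y => ?_)
    push_cast
    ring
  rw [h1, Pi.sub_apply, h6, ← (koopman Φ μ hμ t).norm_map f]
  refine norm_integral_mul_le hε ?_ _
  filter_upwards [hae] with y hy
  rw [Complex.norm_real]
  exact h x hx y hy

/-- The orbits of the range of an integral operator under the Koopman group are differentiable, if
the kernel is differentiable along the flow in its first variable. -/
theorem exists_hasDerivAt_koopman_kernelOp [BorelSpace Ω] [IsProbabilityMeasure μ]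
    (hμ : IsErgodicFlow Φ μ) (hμX : μ μ.supportᶜ = 0) {k : Ω → Ω → ℝ} (hk : IsBoundedKernel k)
    {C : ℝ} (hC : 0 ≤ C)
    (hL : ∀ x ∈ μ.support, ∀ y ∈ μ.support, ∀ s, |k (Φ s x) y - k x y| ≤ C * |s|)
    (hd : ∀ x ∈ μ.support, ∀ y ∈ μ.support, DifferentiableAt ℝ (fun s => k (Φ s x) y) 0)
    (f : Lp ℂ 2 μ) :
    ∃ f', HasDerivAt (fun t => koopman Φ μ hμ t (kernelOp μ k hk f)) f' 0 ∧ ‖f'‖ ≤ C * ‖f‖ := by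
  have hae : ∀ᵐ x ∂μ, x ∈ μ.support := mem_ae_iff.mpr hμX
  have hint := fun x => integrable_kernel_mul hk (integrable_of_Lp_two f) x
  refine exists_hasDerivAt_koopman hμ (kernelOp_apply_ae hk f) (by positivity) ?_ ?_
  · filter_upwards [hae] with x hx s
    rw [kernelIntegral, kernelIntegral, ← integral_sub (hint _) (hint _),
      show C * ‖f‖ * |s| = C * |s| * ‖f‖ by ring]
    have h1 : ∀ y, (k (Φ s x) y : ℂ) * f y - (k x y : ℂ) * f y =
        ((k (Φ s x) y - k x y : ℝ) : ℂ) * f y := fun y => by push_cast; ring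
    simp only [h1]
    refine norm_integral_mul_le (by positivity) ?_ f
    filter_upwards [hae] with y hy
    rw [Complex.norm_real]
    exact hL x hx y hy s
  · filter_upwards [hae] with x hx
    have hcont : Continuous (Function.uncurry fun (y : Ω) (s : ℝ) => k (Φ s x) y) :=
      hk.continuous.comp ((Φ.continuous continuous_snd continuous_const).prodMk continuous_fst)
    have hm : AEStronglyMeasurable
        (fun y => ((deriv (fun s => k (Φ s x) y) 0 : ℝ) : ℂ) * f y) μ := by
      have h1 := (measurable_deriv_with_param hcont).comp (measurable_prodMk_right (y := (0 : ℝ)))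
      exact (Complex.measurable_ofReal.comp h1).aestronglyMeasurable.mul
        (Lp.aestronglyMeasurable f)
    refine (hasDerivAt_integral_of_dominated_loc_of_lip (μ := μ)
      (F := fun s y => (k (Φ s x) y : ℂ) * f y) (bound := fun y => C * ‖f y‖) (s := univ)
      univ_mem (Eventually.of_forall fun s => (hint _).1) (hint _) hm ?_
      ((integrable_of_Lp_two f).norm.const_mul C) ?_).2.differentiableAt
    · filter_upwards [hae] with y hy
      refine LipschitzOnWith.of_dist_le_mul fun s _ r _ => ?_
      rw [dist_eq_norm, dist_eq_norm, ← sub_mul, norm_mul, ← Complex.ofReal_sub, Complex.norm_real,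
        Real.coe_nnabs, abs_of_nonneg (by positivity : 0 ≤ C * ‖f y‖)]
      have h1 := hL (Φ r x) (flow_mem_support hμ hx r) y hy (s - r)
      rw [← Φ.map_add, sub_add_cancel] at h1
      rw [Real.norm_eq_abs, Real.norm_eq_abs]
      calc _ ≤ C * |s - r| * ‖f y‖ := mul_le_mul_of_nonneg_right h1 (norm_nonneg _)
        _ = _ := by ring
    · filter_upwards [hae] with y hy
      exact ((hd x hx y hy).hasDerivAt.ofReal_comp).mul_const (f y)

end Koopman

section DelayKernelBounds

open Filter Topology

variable {Ω : Type*} [MetricSpace Ω] {Y : Type*} [NormedAddCommGroup Y] {Φ : Flow ℝ Ω} {F : Ω → Y}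

omit [MetricSpace Ω] in
theorem sqDist_comm (F : Ω → Y) (x y : Ω) : sqDist F x y = sqDist F y x := by
  rw [sqDist, sqDist, norm_sub_rev]

theorem delayKernel_comm (Φ : Flow ℝ Ω) (F : Ω → Y) (h : ℝ → ℝ) (T : ℝ) (x y : Ω) :
    delayKernel Φ F h T x y = delayKernel Φ F h T y x := by
  simp only [delayKernel, delaySqDist, sqDist_comm F]

theorem halfLineC1Norm_nonneg (h : ℝ → ℝ) : 0 ≤ halfLineC1Norm h :=
  le_max_of_le_left (Real.iSup_nonneg fun _ => abs_nonneg _)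

theorem IsShapeFunction.abs_sub_le {h : ℝ → ℝ} (hh : IsShapeFunction h) {u w : ℝ} (hu : 0 ≤ u)
    (hw : 0 ≤ w) : |h u - h w| ≤ halfLineC1Norm h * |u - w| := by
  obtain ⟨C, hC⟩ := hh.bounded_deriv
  have hbdd : BddAbove (range fun u : Ici (0 : ℝ) => |derivWithin h (Ici 0) u|) :=
    ⟨C, by rintro _ ⟨u, rfl⟩; exact hC u u.2⟩
  exact (convex_Ici 0).norm_image_sub_le_of_norm_derivWithin_le
    (hh.contDiffOn.differentiableOn one_ne_zero)
    (fun u hu => (le_ciSup hbdd ⟨u, hu⟩).trans (le_max_right _ _)) hw hu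

omit [MetricSpace Ω] in
theorem supNormOn_nonneg (X : Set Ω) (f : Ω → Ω → ℝ) : 0 ≤ supNormOn X f :=
  Real.iSup_nonneg fun _ => abs_nonneg _

theorem abs_le_supNormOn {X : Set Ω} (hX : IsCompact X) {f : Ω → Ω → ℝ}
    (hf : Continuous fun p : Ω × Ω => f p.1 p.2) {x y : Ω} (hx : x ∈ X) (hy : y ∈ X) :
    |f x y| ≤ supNormOn X f := by
  have : CompactSpace X := isCompact_iff_compactSpace.mp hX
  have hc : Continuous (fun p : X × X => |f p.1 p.2|) :=
    (hf.comp (continuous_subtype_val.prodMap continuous_subtype_val)).abs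
  exact le_ciSup (isCompact_range hc).bddAbove (⟨x, hx⟩, ⟨y, hy⟩)

theorem continuous_sqDist (hF : Continuous F) : Continuous fun p : Ω × Ω => sqDist F p.1 p.2 :=
  (((hF.comp continuous_fst).sub (hF.comp continuous_snd)).norm).pow 2

theorem continuous_sqDist_orbit (hF : Continuous F) (x y : Ω) :
    Continuous fun t => sqDist F (Φ t x) (Φ t y) :=
  (continuous_sqDist hF).comp ((Φ.continuous continuous_id continuous_const).prodMk
    (Φ.continuous continuous_id continuous_const))

/-- The delay-coordinate distance is nearly invariant under the flow. -/
theorem abs_delaySqDist_flow_sub_le {X : Set Ω} (hX : IsCompact X)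
    (hΦX : ∀ x ∈ X, ∀ t, Φ t x ∈ X) (hF : Continuous F) {T t : ℝ} (hT : 0 < T) (ht : 0 ≤ t)
    {x y : Ω} (hx : x ∈ X) (hy : y ∈ X) :
    |delaySqDist Φ F T (Φ t x) (Φ t y) - delaySqDist Φ F T x y| ≤
      2 * supNormOn X (sqDist F) * t / T := by
  set q : ℝ → ℝ := fun u => sqDist F (Φ u x) (Φ u y) with hq
  have hqc : Continuous q := continuous_sqDist_orbit hF x y
  have hqb : ∀ u, ‖q u‖ ≤ supNormOn X (sqDist F) := fun u =>
    abs_le_supNormOn hX (continuous_sqDist hF) (hΦX x hx u) (hΦX y hy u)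
  have hi : ∀ a b, IntervalIntegrable q volume a b := fun a b => hqc.intervalIntegrable a b
  have h1 : delaySqDist Φ F T (Φ t x) (Φ t y) = 1 / T * ∫ u in t..(T + t), q u := by
    rw [delaySqDist]
    have h2 := intervalIntegral.integral_comp_add_right (a := 0) (b := T) q t
    rw [zero_add] at h2
    rw [← h2]
    simp only [hq, Φ.map_add]
  have h2 : delaySqDist Φ F T (Φ t x) (Φ t y) - delaySqDist Φ F T x y =
      1 / T * ((∫ u in T..(T + t), q u) - ∫ u in (0 : ℝ)..t, q u) := by
    rw [h1, delaySqDist, ← mul_sub,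
      intervalIntegral.integral_interval_sub_interval_comm' (hi _ _) (hi _ _) (hi _ _)]
  have h3 := intervalIntegral.norm_integral_le_of_norm_le_const (a := T) (b := T + t)
    (fun u _ => hqb u)
  have h4 := intervalIntegral.norm_integral_le_of_norm_le_const (a := 0) (b := t)
    (fun u _ => hqb u)
  rw [add_sub_cancel_left, abs_of_nonneg ht] at h3
  rw [sub_zero, abs_of_nonneg ht] at h4
  rw [h2, abs_mul, abs_of_pos (by positivity : 0 < 1 / T), one_div_mul_eq_div]
  gcongr
  have h5 := norm_sub_le (∫ u in T..(T + t), q u) (∫ u in (0 : ℝ)..t, q u)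
  rw [Real.norm_eq_abs] at h5
  linarith

theorem abs_delayKernel_flow_sub_le {X : Set Ω} (hX : IsCompact X)
    (hΦX : ∀ x ∈ X, ∀ t, Φ t x ∈ X) (hF : Continuous F) {h : ℝ → ℝ} (hh : IsShapeFunction h)
    {T t : ℝ} (hT : 0 < T) (ht : 0 ≤ t) {x y : Ω} (hx : x ∈ X) (hy : y ∈ X) :
    |delayKernel Φ F h T (Φ t x) (Φ t y) - delayKernel Φ F h T x y| ≤
      2 * halfLineC1Norm h * supNormOn X (sqDist F) / T * t := by
  refine (hh.abs_sub_le (delaySqDist_nonneg Φ F hT _ _) (delaySqDist_nonneg Φ F hT _ _)).trans ?_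
  refine (mul_le_mul_of_nonneg_left (abs_delaySqDist_flow_sub_le hX hΦX hF hT ht hx hy)
    (halfLineC1Norm_nonneg h)).trans (le_of_eq ?_)
  ring

section Derivative

variable {X : Set Ω} (hΦX : ∀ x ∈ X, ∀ t, Φ t x ∈ X) {B : ℝ}
  (hD : ∀ x ∈ X, ∀ y ∈ X, ∀ s, ∃ D, HasDerivAt (fun s => sqDist F (Φ s x) y) D s ∧ |D| ≤ B)

include hD in
theorem abs_sqDist_flow_sub_le {x y : Ω} (hx : x ∈ X) (hy : y ∈ X) (s r : ℝ) :
    |sqDist F (Φ s x) y - sqDist F (Φ r x) y| ≤ B * |s - r| := by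
  choose D hD1 hD2 using hD x hx y hy
  exact convex_univ.norm_image_sub_le_of_norm_hasDerivWithin_le
    (fun s _ => (hD1 s).hasDerivWithinAt) (fun s _ => hD2 s) (mem_univ r) (mem_univ s)

include hΦX hD

/-- The delay-coordinate distance is differentiable along the flow in its first variable. -/
theorem differentiableAt_delaySqDist_flow (hF : Continuous F) {T : ℝ} {x y : Ω}
    (hx : x ∈ X) (hy : y ∈ X) :
    DifferentiableAt ℝ (fun s => delaySqDist Φ F T (Φ s x) y) 0 := by
  have hcont : Continuous (Function.uncurry fun t s : ℝ => sqDist F (Φ t (Φ s x)) (Φ t y)) :=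
    (continuous_sqDist hF).comp
      ((Φ.continuous continuous_fst (Φ.continuous continuous_snd continuous_const)).prodMk
        (Φ.continuous continuous_fst continuous_const))
  have hcomm : ∀ t s : ℝ, Φ t (Φ s x) = Φ s (Φ t x) := fun t s => by
    rw [← Φ.map_add, ← Φ.map_add, add_comm]
  have hB : 0 ≤ B := by
    obtain ⟨D, -, h⟩ := hD x hx y hy 0
    exact (abs_nonneg D).trans h
  refine DifferentiableAt.const_mul ?_ (1 / T)
  refine (intervalIntegral.hasDerivAt_integral_of_dominated_loc_of_lip (μ := volume)
    (F := fun s t => sqDist F (Φ t (Φ s x)) (Φ t y)) (bound := fun _ => B) (s := univ)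
    (F' := fun t => deriv (fun s => sqDist F (Φ t (Φ s x)) (Φ t y)) 0)
    univ_mem (Eventually.of_forall fun s => (continuous_sqDist_orbit hF _ _).aestronglyMeasurable)
    ((continuous_sqDist_orbit hF _ _).intervalIntegrable _ _) ?_ ?_ intervalIntegrable_const
    ?_).2.differentiableAt
  · exact ((measurable_deriv_with_param hcont).comp
      (measurable_prodMk_right (y := (0 : ℝ)))).aestronglyMeasurable
  · refine Eventually.of_forall fun t _ => LipschitzOnWith.of_dist_le_mul fun s _ r _ => ?_
    rw [Real.dist_eq, Real.dist_eq, Real.coe_nnabs, abs_of_nonneg hB, hcomm t s, hcomm t r]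
    exact abs_sqDist_flow_sub_le hD (hΦX x hx t) (hΦX y hy t) s r
  · refine Eventually.of_forall fun t _ => ?_
    simp only [hcomm t]
    obtain ⟨D, hD1, -⟩ := hD (Φ t x) (hΦX x hx t) (Φ t y) (hΦX y hy t) 0
    exact hD1.differentiableAt.hasDerivAt

theorem abs_delaySqDist_sub_le (hF : Continuous F) {T : ℝ} (hT : 0 < T) {x y : Ω}
    (hx : x ∈ X) (hy : y ∈ X) (s : ℝ) :
    |delaySqDist Φ F T (Φ s x) y - delaySqDist Φ F T x y| ≤ B * |s| := by
  have h1 : ∀ t, ‖sqDist F (Φ t (Φ s x)) (Φ t y) - sqDist F (Φ t x) (Φ t y)‖ ≤ B * |s| :=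
    fun t => by
      have := abs_sqDist_flow_sub_le hD (hΦX x hx t) (hΦX y hy t) s 0
      rwa [Φ.map_zero_apply, sub_zero, ← Φ.map_add, add_comm, Φ.map_add] at this
  have h2 := intervalIntegral.norm_integral_le_of_norm_le_const (a := 0) (b := T)
    (fun t _ => h1 t)
  rw [intervalIntegral.integral_sub ((continuous_sqDist_orbit hF _ _).intervalIntegrable _ _)
    ((continuous_sqDist_orbit hF _ _).intervalIntegrable _ _), sub_zero, abs_of_pos hT,
    Real.norm_eq_abs] at h2
  rw [delaySqDist, delaySqDist, ← mul_sub, abs_mul, abs_of_pos (by positivity : 0 < 1 / T),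
    one_div_mul_eq_div, div_le_iff₀ hT]
  exact h2

theorem abs_delayKernel_sub_le (hF : Continuous F) {h : ℝ → ℝ} (hh : IsShapeFunction h) {T : ℝ}
    (hT : 0 < T) {x y : Ω} (hx : x ∈ X) (hy : y ∈ X) (s : ℝ) :
    |delayKernel Φ F h T (Φ s x) y - delayKernel Φ F h T x y| ≤ halfLineC1Norm h * B * |s| := by
  rw [mul_assoc]
  exact (hh.abs_sub_le (delaySqDist_nonneg Φ F hT _ _) (delaySqDist_nonneg Φ F hT _ _)).trans
    (mul_le_mul_of_nonneg_left (abs_delaySqDist_sub_le hΦX hD hF hT hx hy s)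
      (halfLineC1Norm_nonneg h))

theorem differentiableAt_delayKernel_flow (hF : Continuous F) {h : ℝ → ℝ}
    (hh : IsShapeFunction h) {T : ℝ} (hT : 0 < T) {x y : Ω} (hx : x ∈ X) (hy : y ∈ X) :
    DifferentiableAt ℝ (fun s => delayKernel Φ F h T (Φ s x) y) 0 := by
  have h1 := (differentiableAt_delaySqDist_flow hΦX hD hF (T := T) hx hy).hasDerivAt
  have h2 := (hh.contDiffOn.differentiableOn one_ne_zero _
    (delaySqDist_nonneg Φ F hT (Φ 0 x) y)).hasDerivWithinAt
  exact (h2.comp_hasDerivAt 0 h1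
    (Eventually.of_forall fun s => delaySqDist_nonneg Φ F hT _ _)).differentiableAt

end Derivative

end DelayKernelBounds

section Support

open Filter Topology

variable {Ω : Type*} [MetricSpace Ω] [MeasurableSpace Ω] [BorelSpace Ω] {Φ : Flow ℝ Ω}
  {μ : Measure Ω} [IsProbabilityMeasure μ]

/-- If `L²` has two orthogonal unit vectors, then the support of the ergodic measure is
infinite. -/
theorem infinite_support (hμ : IsErgodicFlow Φ μ) (hμX : μ μ.supportᶜ = 0) {φ ψ : Lp ℂ 2 μ}
    (hφ1 : ‖φ‖ = 1) (hψ1 : ‖ψ‖ = 1) (hφψ : inner ℂ φ ψ = 0) : μ.support.Infinite := by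
  intro hfin
  obtain ⟨x, hx, hμx⟩ : ∃ x ∈ μ.support, μ {x} ≠ 0 := by
    by_contra! hcon
    have h1 : μ μ.support = 0 := by
      rw [← biUnion_of_singleton μ.support]
      exact (measure_biUnion_null_iff hfin.countable).mpr hcon
    have h2 : μ univ ≤ 0 := by
      rw [← union_compl_self μ.support]
      exact (measure_union_le _ _).trans (by rw [h1, hμX, add_zero])
    simp at h2
  have hfix : ∀ t, Φ t x = x := fun t => by
    have hpre : IsPreconnected (range fun t => Φ t x) :=
      isPreconnected_range (Φ.continuous continuous_id continuous_const)
    have hsub : (range fun t => Φ t x).Subsingleton := by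
      rw [← not_nontrivial_iff]
      intro hnt
      refine hpre.infinite_of_nontrivial hnt (hfin.subset ?_)
      rintro _ ⟨t, rfl⟩
      exact flow_mem_support hμ hx t
    simpa using hsub ⟨t, rfl⟩ ⟨0, rfl⟩
  have hinv : ∀ t, Φ t ⁻¹' {x} = {x} := fun t => by
    ext y
    simp only [mem_preimage, mem_singleton_iff]
    refine ⟨fun h => ?_, fun h => h ▸ hfix t⟩
    rw [← hfix (-t), ← h, ← Φ.map_add, neg_add_cancel, Φ.map_zero_apply]
  have hae : ∀ᵐ y ∂μ, y = x :=
    mem_ae_iff.mpr ((hμ.ergodic {x} (measurableSet_singleton x) hinv).resolve_left hμx)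
  have hnorm : ∀ f : Lp ℂ 2 μ, ‖f‖ = 1 → f x ≠ 0 := fun f hf h0 => by
    have h1 : ‖f‖ ^ 2 = ∫ _, (0 : ℝ) ∂μ := by
      rw [norm_sq_eq_integral]
      refine integral_congr_ae ?_
      filter_upwards [hae] with y hy
      rw [hy, h0]
      simp
    rw [hf] at h1
    simp at h1
  have h2 : inner ℂ φ ψ = inner ℂ (φ x) (ψ x) := by
    rw [L2.inner_def]
    have h3 : ∫ y, inner ℂ (φ y) (ψ y) ∂μ = ∫ _, inner ℂ (φ x) (ψ x) ∂μ := by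
      refine integral_congr_ae ?_
      filter_upwards [hae] with y hy
      rw [hy]
    rw [h3]
    simp
  rw [hφψ] at h2
  have h3 := hnorm φ hφ1
  have h4 := hnorm ψ hψ1
  simp [h3, h4] at h2

omit [IsProbabilityMeasure μ] in
theorem exists_ne_zero_orthogonal [IsFiniteMeasure μ] (hinf : μ.support.Infinite)
    (φ ψ : Lp ℂ 2 μ) : ∃ w : Lp ℂ 2 μ, w ≠ 0 ∧ inner ℂ φ w = 0 ∧ inner ℂ ψ w = 0 := by
  obtain ⟨t, htX, ht⟩ := hinf.exists_subset_card_eq 3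
  obtain ⟨A, hA, hdisj⟩ := t.finite_toSet.t2_separation
  let e : t → Lp ℂ 2 μ := fun i =>
    indicatorConstLp 2 (hA i).2.measurableSet (measure_ne_top μ _) (1 : ℂ)
  have hli : LinearIndependent ℂ e := by
    refine linearIndependent_of_ne_zero_of_inner_eq_zero (𝕜 := ℂ) (fun i => ?_) fun i j hij => ?_
    · have hpos := (Measure.mem_support_iff_forall (i : Ω)).mp (htX i.2) _
        ((hA i).2.mem_nhds (hA i).1)
      intro h0
      have h1 := norm_indicatorConstLp (μ := μ) (p := 2) (hs := (hA i).2.measurableSet)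
        (hμs := measure_ne_top μ _) (c := (1 : ℂ)) (by norm_num) (by norm_num)
      have h2 : ‖e i‖ = 0 := by rw [h0, norm_zero]
      rw [show ‖e i‖ = _ from h1, norm_one, one_mul] at h2
      have h3 : 0 < μ.real (A i) := ENNReal.toReal_pos hpos.ne' (measure_ne_top μ _)
      exact (Real.rpow_pos_of_pos h3 _).ne' h2
    · change inner ℂ (e i) (e j) = 0
      rw [L2.inner_indicatorConstLp_one_indicatorConstLp_one (hA i).2.measurableSet
        (hA j).2.measurableSet (measure_ne_top μ _) (measure_ne_top μ _), (hdisj i.2 j.2 (fun h => hij (Subtype.ext h))).inter_eq]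
      simp
  set W : Submodule ℂ (Lp ℂ 2 μ) := Submodule.span ℂ {φ, ψ} with hW
  have hfd : FiniteDimensional ℂ W := FiniteDimensional.span_of_finite ℂ (toFinite _)
  by_contra! hcon
  have hbot : Wᗮ = ⊥ := by
    rw [Submodule.eq_bot_iff]
    intro w hw
    by_contra hw0
    exact hcon w hw0 (hw φ (Submodule.subset_span (by simp)))
      (hw ψ (Submodule.subset_span (by simp)))
  have htop : W = ⊤ := (Submodule.orthogonal_eq_bot_iff).mp hbot
  have hle : Module.finrank ℂ W ≤ 2 := by
    classical
    have h1 := finrank_span_finset_le_card (R := ℂ) ({φ, ψ} : Finset (Lp ℂ 2 μ))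
    rw [Finset.coe_pair] at h1
    exact h1.trans Finset.card_le_two
  have : FiniteDimensional ℂ (Lp ℂ 2 μ) := by
    rw [htop] at hfd
    exact Module.finite_def.mpr (Submodule.fg_top _ |>.mp hfd.1)
  have h3 := hli.fintype_card_le_finrank
  rw [htop, finrank_top] at hle
  rw [Fintype.card_coe, ht] at h3
  omega

end Support

section Generator

variable {Ω : Type*} [MetricSpace Ω] [MeasurableSpace Ω] {Φ : Flow ℝ Ω} {μ : Measure Ω}

theorem exists_generator_apply (hμ : IsErgodicFlow Φ μ) {f f' : Lp ℂ 2 μ}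
    (h : HasDerivAt (fun t => koopman Φ μ hμ t f) f' 0) :
    ∃ hf : f ∈ (generator Φ μ hμ).domain, generator Φ μ hμ ⟨f, hf⟩ = f' :=
  ⟨h.differentiableAt, h.deriv⟩

/-- The generator is skew-symmetric and real, so that its matrix in a real orthonormal pair is
antisymmetric and real. -/
theorem exists_inner_generator_eq (hμ : IsErgodicFlow Φ μ) {φ ψ φ' ψ' : Lp ℂ 2 μ}
    (hφ : HasDerivAt (fun t => koopman Φ μ hμ t φ) φ' 0)
    (hψ : HasDerivAt (fun t => koopman Φ μ hμ t ψ) ψ' 0)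
    (hφr : ∀ᵐ x ∂μ, (φ x).im = 0) (hψr : ∀ᵐ x ∂μ, (ψ x).im = 0) :
    ∃ ω : ℝ, inner ℂ φ φ' = 0 ∧ inner ℂ ψ ψ' = 0 ∧ inner ℂ φ ψ' = (ω : ℂ) ∧
      inner ℂ ψ φ' = -(ω : ℂ) := by
  have hreal : ∀ {f g g' : Lp ℂ 2 μ}, (∀ᵐ x ∂μ, (f x).im = 0) → (∀ᵐ x ∂μ, (g x).im = 0) →
      HasDerivAt (fun t => koopman Φ μ hμ t g) g' 0 →
      inner ℂ f g' = (((inner ℂ f g' : ℂ).re : ℝ) : ℂ) ∧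
        inner ℂ g' f = (((inner ℂ f g' : ℂ).re : ℝ) : ℂ) := by
    intro f g g' hf hg hd
    have h1 : inner ℂ f g' = (((inner ℂ f g' : ℂ).re : ℝ) : ℂ) :=
      Complex.ext (by simp) (by simpa using im_inner_generator_eq_zero hμ hf hg hd)
    refine ⟨h1, ?_⟩
    rw [← inner_conj_symm, h1, Complex.conj_ofReal, Complex.ofReal_re]
  have hdiag : ∀ {f f' : Lp ℂ 2 μ}, (∀ᵐ x ∂μ, (f x).im = 0) →
      HasDerivAt (fun t => koopman Φ μ hμ t f) f' 0 → inner ℂ f f' = 0 := by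
    intro f f' hf hd
    have h1 := inner_deriv_add_inner_deriv_eq_zero (koopman_zero hμ) hd hd
    rw [(hreal hf hf hd).2, ← (hreal hf hf hd).1] at h1
    exact add_self_eq_zero.mp h1
  refine ⟨(inner ℂ φ ψ' : ℂ).re, hdiag hφr hφ, hdiag hψr hψ, (hreal hφr hψr hψ).1, ?_⟩
  have h1 := inner_deriv_add_inner_deriv_eq_zero (koopman_zero hμ) hφ hψ
  rw [(hreal hψr hφr hφ).2, ← (hreal hψr hφr hφ).1, (hreal hφr hψr hψ).1] at h1
  exact eq_neg_of_add_eq_zero_right h1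

end Generator

section Eigenfunctions

variable {Ω : Type*} [MetricSpace Ω] [MeasurableSpace Ω] {Φ : Flow ℝ Ω} {μ : Measure Ω}

/-- Eigenfunctions for positive eigenvalues are differentiable along the Koopman group. -/
theorem exists_hasDerivAt_eigenfunction (hμ : IsErgodicFlow Φ μ) {K : Lp ℂ 2 μ →L[ℂ] Lp ℂ 2 μ}
    {C : ℝ} (hK : ∀ f, ∃ f', HasDerivAt (fun t => koopman Φ μ hμ t (K f)) f' 0 ∧ ‖f'‖ ≤ C * ‖f‖)
    {lam : ℝ} (hlam : 0 < lam) {φ : Lp ℂ 2 μ} (hφ : φ ∈ eigenspace K lam) (hφ1 : ‖φ‖ = 1) :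
    ∃ φ', HasDerivAt (fun t => koopman Φ μ hμ t φ) φ' 0 ∧ ‖φ'‖ ≤ C / lam := by
  rw [mem_eigenspace] at hφ
  obtain ⟨f', hd, hf'⟩ := hK φ
  rw [hφ, hφ1, mul_one] at *
  have hlam0 : (lam : ℂ) ≠ 0 := Complex.ofReal_ne_zero.mpr hlam.ne'
  refine ⟨(lam : ℂ)⁻¹ • f', ?_, ?_⟩
  · have h1 := hd.fun_const_smul (lam : ℂ)⁻¹
    simp only [map_smul, inv_smul_smul₀ hlam0] at h1
    exact h1
  · rw [norm_smul, norm_inv, Complex.norm_real, Real.norm_of_nonneg hlam.le, inv_mul_eq_div]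
    gcongr

end Eigenfunctions

end DelayCoherence
end

theorem theorem1
    -- the flow, its ergodic invariant measure and the compact support of the latter
    {Ω : Type*} [MetricSpace Ω] [MeasurableSpace Ω] [BorelSpace Ω]
    (Φ : Flow ℝ Ω) (μ : Measure Ω) [IsProbabilityMeasure μ] (hμ : IsErgodicFlow Φ μ)
    (hX : IsCompact μ.support) (hμX : μ μ.supportᶜ = 0)
    -- the forward-invariant compact manifold and the vector field on it that generates the flow
    {E : Type*} [NormedAddCommGroup E] [NormedSpace ℝ E] [FiniteDimensional ℝ E]
    {H : Type*} [TopologicalSpace H] (I : ModelWithCorners ℝ E H)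
    (M : Set Ω) [ChartedSpace H M] [IsManifold I 1 M] (hMc : IsCompact M)
    (hXM : μ.support ⊆ M) (hM : ∀ t : ℝ, 0 ≤ t → MapsTo (Φ t) M M)
    (hΦ : ∀ t : ℝ, 0 ≤ t → ContMDiff I I 1 (restrictFlow Φ M hM t))
    (v : ∀ x : M, TangentSpace I x)
    (hv : Continuous (fun x : M => (⟨x, v x⟩ : TangentBundle I M)))
    (hvΦ : ∀ x : M, IsMIntegralCurveOn (fun t : ℝ => restrictFlow Φ M hM t x) v (Ici 0))
    (g : Bundle.ContinuousRiemannianMetric E (fun x : M => TangentSpace I x))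
    -- the observation map
    {Y : Type*} [NormedAddCommGroup Y] [NormedSpace ℝ Y] [CompleteSpace Y]
    (F : Ω → Y) (hF : Continuous F) (hFM : ContMDiff I 𝓘(ℝ, Y) 1 (fun x : M => F x))
    (hd : ContMDiff (I.prod I) 𝓘(ℝ, ℝ) 1 (fun p : M × M => sqDist F p.1 p.2))
    -- the shape function, the delay window and the eigenfunctions
    (h : ℝ → ℝ) (hh : IsShapeFunction h) (T : ℝ) (hT : 0 < T)
    (lam nu : ℝ) (hlam : 0 < lam) (hlamnu : lam ≤ nu)
    (hsimple : lam ≠ nu →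
      Module.finrank ℂ (eigenspace (delayOp Φ μ hF hh hT) lam) = 1 ∧
      Module.finrank ℂ (eigenspace (delayOp Φ μ hF hh hT) nu) = 1)
    (hdouble : lam = nu → Module.finrank ℂ (eigenspace (delayOp Φ μ hF hh hT) lam) = 2)
    (φ ψ : Lp ℂ 2 μ)
    (hφ : φ ∈ eigenspace (delayOp Φ μ hF hh hT) lam)
    (hψ : ψ ∈ eigenspace (delayOp Φ μ hF hh hT) nu)
    (hφr : ∀ᵐ x ∂μ, (φ x).im = 0) (hψr : ∀ᵐ x ∂μ, (ψ x).im = 0)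
    (hφ1 : ‖φ‖ = 1) (hψ1 : ‖ψ‖ = 1) (hφψ : inner ℂ φ ψ = 0) :
    let K := delayOp Φ μ hF hh hT
    let U : ℝ → Lp ℂ 2 μ →ₗᵢ[ℂ] Lp ℂ 2 μ := koopman Φ μ hμ
    let V : Lp ℂ 2 μ →ₗ.[ℂ] Lp ℂ 2 μ := generator Φ μ hμ
    let z : Lp ℂ 2 μ := (1 / (Real.sqrt 2 : ℂ)) • (φ + Complex.I • ψ)
    let α : ℝ → ℂ := fun t => inner ℂ z (U t z)
    let γ : ℝ := spectralGap K lam nu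
    let δ : ℝ := 1 / Real.sqrt 2 * (nu - lam)
    let δ' : ℝ := δ / nu
    let C₁ : ℝ := 2 * halfLineC1Norm h * supNormOn μ.support (sqDist F)
    let C₂ : ℝ := 2 * halfLineC1Norm h *
      c1Norm (I.prod I) (prodMetricSq g) (fun p : M × M => sqDist F p.1 p.2)
    let s : ℝ → ℝ := fun t => 1 / γ * (C₁ * t / T + 3 * δ)
    let S : ℝ → ℝ := fun t =>
      C₂ * vectorFieldNorm g v * (1 + δ') / lam * ∫ u in (0 : ℝ)..t, s u
    0 < γ ∧
    (∀ t : ℝ, 0 ≤ t →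
      α t ∈ approxPointSpectrum (U t) (s t + Real.sqrt (S t)) ∧
      IsApproxEigenfunction (U t) (s t + Real.sqrt (S t)) (α t) z) ∧
    ∃ (hφV : φ ∈ V.domain) (hψV : ψ ∈ V.domain) (hzV : z ∈ V.domain) (ω : ℝ),
      inner ℂ φ (V ⟨ψ, hψV⟩) = (ω : ℂ) ∧
      inner ℂ ψ (V ⟨φ, hφV⟩) = -(ω : ℂ) ∧
      inner ℂ z (V ⟨z, hzV⟩) / Complex.I = (ω : ℂ) ∧
      HasDerivAt α (Complex.I * ω) 0 ∧
      (∀ φ' ψ' : Lp ℂ 2 μ, φ' ∈ eigenspace K lam ⊔ eigenspace K nu →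
        ψ' ∈ eigenspace K lam ⊔ eigenspace K nu →
        (∀ᵐ x ∂μ, (φ' x).im = 0) → (∀ᵐ x ∂μ, (ψ' x).im = 0) →
        ‖φ'‖ = 1 → ‖ψ'‖ = 1 → inner ℂ φ' ψ' = 0 →
        ∃ hφV' : φ' ∈ V.domain, ‖inner ℂ ψ' (V ⟨φ', hφV'⟩)‖ = |ω|) ∧
      ∀ t : ℝ, 0 ≤ t →
        ‖α t - Complex.exp (Complex.I * ω * t)‖ ≤ 2 * Real.sqrt (S t) := by
  intro K U V z α γ δ δ' C₁ C₂ s S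
  have hae : ∀ᵐ x ∂μ, x ∈ μ.support := mem_ae_iff.mpr hμX
  have hΦX : ∀ x ∈ μ.support, ∀ t, Φ t x ∈ μ.support := fun x hx t => flow_mem_support hμ hx t
  have hc : IsCompactOperator K := isCompactOperator_kernelOp hX hμX _
  have hs : (K : Lp ℂ 2 μ →ₗ[ℂ] Lp ℂ 2 μ).IsSymmetric :=
    isSymmetric_kernelOp hX hμX _ (delayKernel_comm Φ F h T)
  have hnu : 0 < nu := hlam.trans_le hlamnu
  have hspan : ∀ e ∈ eigenspace K lam ⊔ eigenspace K nu, ∃ a b : ℂ, e = a • φ + b • ψ :=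
    fun e he => exists_eq_add_of_mem_eigenspace_sup hsimple hdouble hφ hψ hφ1 hψ1 hφψ he
  have hγ : 0 < γ := by
    obtain ⟨w, hw0, hwφ, hwψ⟩ := exists_ne_zero_orthogonal
      (infinite_support hμ hμX hφ1 hψ1 hφψ) φ ψ
    have hw : ∀ e ∈ eigenspace K lam ⊔ eigenspace K nu, inner ℂ e w = 0 := fun e he => by
      obtain ⟨a, b, rfl⟩ := hspan e he
      simp [inner_add_left, inner_smul_left, hwφ, hwψ]
    exact spectralGap_pos hc hs hlam.ne' hnu.ne' (realPointSpectrum_diff_nonempty hc hs hw0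
      (fun e he => hw e (Submodule.mem_sup_left he))
      fun e he => hw e (Submodule.mem_sup_right he))
  have hL := halfLineC1Norm_nonneg h
  have hC₁ : 0 ≤ C₁ := by
    have := supNormOn_nonneg μ.support (sqDist F)
    positivity
  have hcomm : ∀ t, 0 ≤ t → ∀ f, ‖U t (K f) - K (U t f)‖ ≤ C₁ / T * t * ‖f‖ := fun t ht f =>
    norm_koopman_kernelOp_sub_le hμ hμX _ (by positivity) (fun x hx y hy =>
      abs_delayKernel_flow_sub_le hX hΦX hF hh hT ht hx hy) f
  set B₀ : ℝ := vectorFieldNorm g v *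
    c1Norm (I.prod I) (prodMetricSq g) (fun p : M × M => sqDist F p.1 p.2) with hB₀
  have hB₀0 : 0 ≤ B₀ := mul_nonneg (vectorFieldNorm_nonneg g v) (c1Norm_nonneg _ _)
  have hD : ∀ x ∈ μ.support, ∀ y ∈ μ.support, ∀ s, ∃ D,
      HasDerivAt (fun s => sqDist F (Φ s x) y) D s ∧ |D| ≤ B₀ := fun x hx y hy s =>
    exists_hasDerivAt_sqDist_flow hMc hv hvΦ g hd (fun s => hXM (hΦX x hx s)) (hXM hy) s
  have hKd : ∀ f, ∃ f', HasDerivAt (fun t => koopman Φ μ hμ t (K f)) f' 0 ∧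
      ‖f'‖ ≤ halfLineC1Norm h * B₀ * ‖f‖ := fun f =>
    exists_hasDerivAt_koopman_kernelOp hμ hμX _ (mul_nonneg hL hB₀0)
      (fun x hx y hy s => abs_delayKernel_sub_le hΦX hD hF hh hT hx hy s)
      (fun x hx y hy => differentiableAt_delayKernel_flow hΦX hD hF hh hT hx hy) f
  obtain ⟨φ', hφd, hφ'⟩ := exists_hasDerivAt_eigenfunction hμ hKd hlam hφ hφ1
  obtain ⟨ψ', hψd, hψ'⟩ := exists_hasDerivAt_eigenfunction hμ hKd hnu hψ hψ1
  have hB0 : 0 ≤ halfLineC1Norm h * B₀ / lam := div_nonneg (mul_nonneg hL hB₀0) hlam.le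
  have hψ'B : ‖ψ'‖ ≤ halfLineC1Norm h * B₀ / lam :=
    hψ'.trans (div_le_div_of_nonneg_left (mul_nonneg hL hB₀0) hlam hlamnu)
  obtain ⟨ω, h11, h22, h12, h21⟩ := exists_inner_generator_eq hμ hφd hψd hφr hψr
  have hpair : IsCoherentPair U K lam nu φ ψ φ' ψ' ω :=
    { map_zero := koopman_zero hμ
      map_add := koopman_add hμ
      isCompact := hc
      isSymmetric := hs
      le := hlamnu
      gap_pos := hγ
      mem_left := hφ
      mem_right := hψ
      norm_left := hφ1
      norm_right := hψ1
      inner_eq_zero := hφψ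
      span := hspan
      deriv_left := hφd
      deriv_right := hψd
      inner_left_left := h11
      inner_right_right := h22
      inner_left_right := h12
      inner_right_left := h21 }
  have hδ : 0 ≤ δ := mul_nonneg (by positivity) (sub_nonneg.mpr hlamnu)
  have hδ' : 0 ≤ δ' := div_nonneg hδ hnu.le
  have hscont : Continuous s :=
    continuous_const.mul (((continuous_const.mul continuous_id).div_const T).add continuous_const)
  have hs0 : ∀ t, 0 ≤ t → 0 ≤ s t := fun t ht => by positivity
  have hcs : ∀ t, 0 ≤ t → 1 / γ * (C₁ / T * t + 1 / Real.sqrt 2 * (nu - lam)) ≤ s t :=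
    fun t ht => by
      refine mul_le_mul_of_nonneg_left ?_ (by positivity)
      have h1 : C₁ / T * t = C₁ * t / T := by ring
      have h2 : 1 / Real.sqrt 2 * (nu - lam) = δ := rfl
      linarith
  have hSle : ∀ t, 0 ≤ t →
      2 * (halfLineC1Norm h * B₀ / lam) * ∫ u in (0 : ℝ)..t, s u ≤ S t := fun t ht => by
    have hint : 0 ≤ ∫ u in (0 : ℝ)..t, s u :=
      intervalIntegral.integral_nonneg ht fun u hu => hs0 u hu.1
    have h1 : S t = 2 * (halfLineC1Norm h * B₀ / lam) * (∫ u in (0 : ℝ)..t, s u) * (1 + δ') := by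
      simp only [S, C₂, hB₀]
      ring
    rw [h1]
    exact le_mul_of_one_le_right (by positivity) (by linarith)
  have hest := fun t (ht : 0 ≤ t) =>
    hpair.approx_eigenfunction hcomm hB0 hφ' hψ'B hscont hcs ht (hSle t ht)
  have hz1 : ‖z‖ = 1 := norm_complexify hφ1 hψ1 hφψ
  have hzd : HasDerivAt (fun t => U t z) (complexify φ' ψ') 0 := hasDerivAt_complexify hφd hψd
  refine ⟨hγ, fun t ht => ?_, ?_⟩
  · have happ : IsApproxEigenfunction (U t) (s t + Real.sqrt (S t)) (α t) z :=
      ⟨norm_ne_zero_iff.mp (by rw [hz1]; exact one_ne_zero), by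
        rw [hz1, mul_one]; exact (hest t ht).1⟩
    exact ⟨⟨z, happ⟩, happ⟩
  · obtain ⟨hφV, hφVe⟩ := exists_generator_apply hμ hφd
    obtain ⟨hψV, hψVe⟩ := exists_generator_apply hμ hψd
    obtain ⟨hzV, hzVe⟩ := exists_generator_apply hμ hzd
    refine ⟨hφV, hψV, hzV, ω, ?_, ?_, ?_, ?_, ?_, fun t ht => (hest t ht).2⟩
    · rw [hψVe, h12]
    · rw [hφVe, h21]
    · rw [hzVe]
      change inner ℂ (complexify φ ψ) (complexify φ' ψ') / Complex.I = ω
      rw [hpair.inner_complexify_deriv, mul_div_cancel_left₀ _ Complex.I_ne_zero]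
    · have h1 := (hasDerivAt_const (0 : ℝ) z).inner ℂ hzd
      rw [inner_zero_left, add_zero] at h1
      rw [← hpair.inner_complexify_deriv]
      exact h1
    · intro f₁ f₂ hf₁ hf₂ hf₁r hf₂r hf₁n hf₂n hf₁₂
      have hreal : ∀ f, f ∈ eigenspace K lam ⊔ eigenspace K nu → (∀ᵐ x ∂μ, (f x).im = 0) →
          ∃ a b : ℝ, f = (a : ℂ) • φ + (b : ℂ) • ψ := by
        intro f hf hfr
        obtain ⟨a, b, rfl⟩ := hspan f hf
        have ha : (a.re : ℂ) = a := by
          have h1 := im_inner_eq_zero hφr hfr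
          rw [inner_add_right, inner_smul_right, inner_smul_right, hφψ,
            inner_self_eq_norm_sq_to_K, hφ1] at h1
          exact Complex.ext (by simp) (by simpa using h1.symm)
        have hb : (b.re : ℂ) = b := by
          have h1 := im_inner_eq_zero hψr hfr
          rw [inner_add_right, inner_smul_right, inner_smul_right, inner_eq_zero_symm.mp hφψ,
            inner_self_eq_norm_sq_to_K, hψ1] at h1
          exact Complex.ext (by simp) (by simpa using h1.symm)
        exact ⟨a.re, b.re, by rw [ha, hb]⟩
      obtain ⟨a, b, rfl⟩ := hreal f₁ hf₁ hf₁r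
      obtain ⟨c, d, rfl⟩ := hreal f₂ hf₂ hf₂r
      have hd₁ : HasDerivAt (fun t => U t ((a : ℂ) • φ + (b : ℂ) • ψ))
          ((a : ℂ) • φ' + (b : ℂ) • ψ') 0 := by
        simp only [map_add, map_smul]
        exact (hφd.fun_const_smul (a : ℂ)).fun_add (hψd.fun_const_smul (b : ℂ))
      obtain ⟨hV, hVe⟩ := exists_generator_apply hμ hd₁
      exact ⟨hV, by rw [hVe]; exact hpair.norm_inner_deriv_eq hf₁n hf₂n hf₁₂⟩
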